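/- For $n\ge 0$ let $\mathsf{SoS}_2$ be the set of real $n\times n$ matrices $X\succeq 0$ with $X_{ii}=1$ for all $i$. Let $\mathsf{SoS}_4$ be the set of real positive semidefinite matrices $\mathcal M$ with rows and columns indexed by the subsets of $[n]$ of size at most $2$ such that $\mathcal M[\emptyset,\emptyset]=1$ and $\mathcal M[S,T]=\mathcal M[S',T']$ whenever $S\Delta T=S'\Delta T'$. For $X\in\mathsf{SoS}_2$ put $$\alpha_{\mathrm{mag}}=\max_{i\ne j}|X_{ij}|,\qquad \alpha_{\mathrm{row}}=\max_i\Big(\sum_{j\ne i}X_{ij}^2\Big)^{1/2},\qquad \alpha_{\mathrm{spec}}=\|X\|$$ (spectral norm; a maximum over the empty set is $0$), and, for $C>0$, $\alpha=C\,\alpha_{\mathrm{mag}}(1+\alpha_{\mathrm{row}}^4)(1+\alpha_{\mathrm{spec}}^2)$. The map $\Phi$ is defined as follows. Write $X=MM^{\top}$ with $M\in\mathbb R^{n\times n}$. For $\kappa\ge n$ a power of $2$ let $M_\kappa=MH_\kappa^{\le n}$, where $H_\kappa^{\le n}$ consists of the first $n$ rows of the Sylvester–Hadamard matrix of order $\kappa$,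 normalized to be orthogonal. For $z\in\{\pm1\}^\kappa$ let $$q_{i,\kappa}(z)=\sum_{j\in[\kappa]}M_\kappa[i,j]z_j-2\sum_{\{j_1,j_2,j_3\}\subseteq[\kappa]}M_\kappa[i,j_1]M_\kappa[i,j_2]M_\kappa[i,j_3]\,z_{j_1}z_{j_2}z_{j_3},$$ where the second sum is over $3$-element subsets, and set $$\mathcal M^{(1)}[S,T]=\lim_{\kappa\to\infty}\mathbb E_{z\sim\{\pm1\}^\kappa}\Big[\prod_{i\in S\Delta T}q_{i,\kappa}(z)\Big],\qquad \Phi(X)=\frac{1}{1+\alpha}\,\mathcal M^{(1)}+\frac{\alpha}{1+\alpha}\,\mathrm{Id}.$$ **Theorem.** There is an absolute constant $C>0$ such that for every $n$ and every $X\in\mathsf{SoS}_2$: the limits defining $\mathcal M^{(1)}$ exist and do not depend on the choice of $M$; $\Phi(X)\in\mathsf{SoS}_4$; and for all $i\ne j$ $$\Phi(X)[\{i\},\{j\}]=\frac{X_{ij}+\tfrac23X_{ij}^3}{1+C\,\alpha_{\mathrm{mag}}(1+\alpha_{\mathrm{row}}^4)(1+\alpha_{\mathrm{spec}}^2)} .$$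 Moreover, there are polynomials $Q_k$ with rational coefficients in variables $y_{ab}$, $1\le a,b\le k$, independent of $n$ and $X$, such that for all $S,T$ and every enumeration $i_1,\dots,i_k$ of $S\Delta T$ without repetition $$\Phi(X)[S,T]=\frac{Q_k\big((X_{i_ai_b})_{a,b}\big)+\alpha\,\mathbf 1[S=T]}{1+\alpha}.$$ Thus, apart from the scalar $\alpha$, every entry $\Phi(X)[S,T]$ is a polynomial of constant degree in the $X_{ij}$ with $i,j\in S\cup T$. -/

import Mathlib

open scoped BigOperators symmDiff

noncomputable section

namespace SoSLift

/-- Feasible solutions of the degree-2 SoS (Goemans–Williamson) relaxation. -/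
def SoS2 (n : ℕ) : Set (Matrix (Fin n) (Fin n) ℝ) :=
  {X | X.PosSemidef ∧ ∀ i, X i i = 1}

/-- Subsets of `[n]` of size at most two, the index set of degree-4 pseudomoment matrices. -/
abbrev Idx (n : ℕ) : Type := {S : Finset (Fin n) // S.card ≤ 2}

/-- The singleton `{i}` as an index. -/
def single {n : ℕ} (i : Fin n) : Idx n := ⟨{i}, by simp⟩

/-- The empty set as an index. -/
def emptyIdx (n : ℕ) : Idx n := ⟨∅, by simp⟩

/-- Feasible solutions of the degree-4 SoS relaxation on Boolean variables. -/
def SoS4 (n : ℕ) : Set (Matrix (Idx n) (Idx n) ℝ) :=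
  {P | (∀ S T S' T' : Idx n, S.1 ∆ T.1 = S'.1 ∆ T'.1 → P S T = P S' T') ∧
    P (emptyIdx n) (emptyIdx n) = 1 ∧ P.PosSemidef}

/-- Largest magnitude of an off-diagonal entry (`0` if there is none). -/
def alphaMag {n : ℕ} (X : Matrix (Fin n) (Fin n) ℝ) : ℝ :=
  ⨆ p : {p : Fin n × Fin n // p.1 ≠ p.2}, |X p.1.1 p.1.2|

/-- Largest Euclidean norm of a row, the diagonal entry being left out. -/
def alphaRow {n : ℕ} (X : Matrix (Fin n) (Fin n) ℝ) : ℝ :=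
  ⨆ i : Fin n, √(∑ j ∈ Finset.univ.erase i, X i j ^ 2)

/-- Spectral norm: the operator norm for the Euclidean norm. -/
def alphaSpec {n : ℕ} (X : Matrix (Fin n) (Fin n) ℝ) : ℝ :=
  ‖Matrix.toEuclideanCLM (𝕜 := ℝ) X‖

def alpha (C : ℝ) {n : ℕ} (X : Matrix (Fin n) (Fin n) ℝ) : ℝ :=
  C * alphaMag X * (1 + alphaRow X ^ 4) * (1 + alphaSpec X ^ 2)

/-- Entry `(a, b)` of the normalized Sylvester–Hadamard matrix of order `2 ^ m`
(rows and columns are numbered from `0`): `(-1) ^ ⟨a, b⟩ / √(2 ^ m)`, where `⟨a, b⟩` is the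
inner product of the binary expansions of `a` and `b`. -/
def hadamard (m a b : ℕ) : ℝ :=
  (∏ t ∈ Finset.range m, if a.testBit t ∧ b.testBit t then (-1 : ℝ) else 1) / √(2 ^ m)

/-- The `n × 2 ^ m` matrix `M * H`, where `H` consists of the first `n` rows of the Hadamard
matrix of order `2 ^ m`. It is meant for `n ≤ 2 ^ m`; only large `m` matter below. -/
def spread {n : ℕ} (M : Matrix (Fin n) (Fin n) ℝ) (m : ℕ) : Matrix (Fin n) (Fin (2 ^ m)) ℝ :=
  M * Matrix.of fun (k : Fin n) (j : Fin (2 ^ m)) => hadamard m k.val j.val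

/-- Seed polynomial of the index `i`, evaluated at a sign vector `z`. -/
def seed {n κ : ℕ} (A : Matrix (Fin n) (Fin κ) ℝ) (i : Fin n) (z : Fin κ → ℤˣ) : ℝ :=
  ∑ j, A i j * ((z j : ℤ) : ℝ)
    - 2 * ∑ J ∈ Finset.powersetCard 3 Finset.univ, ∏ j ∈ J, A i j * ((z j : ℤ) : ℝ)

/-- Average over a uniformly random sign vector `z ∈ {±1} ^ (2 ^ m)` of the product of the seed
polynomials of the indices in `U`. -/
def seedMoment {n : ℕ} (M : Matrix (Fin n) (Fin n) ℝ) (U : Finset (Fin n)) (m : ℕ) : ℝ :=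
  𝔼 z : Fin (2 ^ m) → ℤˣ, ∏ i ∈ U, seed (spread M m) i z

open Classical in
/-- Some square matrix `M` with `M * Mᵀ = X`; there is one if `X` is positive semidefinite. -/
def factor {n : ℕ} (X : Matrix (Fin n) (Fin n) ℝ) : Matrix (Fin n) (Fin n) ℝ :=
  if h : ∃ M : Matrix (Fin n) (Fin n) ℝ, M * M.transpose = X then h.choose else 0

/-- The matrix of limiting seed moments. -/
def momentMatrix {n : ℕ} (X : Matrix (Fin n) (Fin n) ℝ) : Matrix (Idx n) (Idx n) ℝ :=
  Matrix.of fun S T => Filter.limUnder Filter.atTop (seedMoment (factor X) (S.1 ∆ T.1))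

/-- The lift `(1 - η) • momentMatrix X + η • 1` with `η = α / (1 + α)`. -/
def lift (C : ℝ) {n : ℕ} (X : Matrix (Fin n) (Fin n) ℝ) : Matrix (Idx n) (Idx n) ℝ :=
  (1 - alpha C X / (1 + alpha C X)) • momentMatrix X + (alpha C X / (1 + alpha C X)) • 1

end SoSLift

end

/-
The rows of `spread M m` have entries tending to zero, so integration by parts on the cube shows
that the linear forms `∑ j, spread M m i j * z j` satisfy Stein's identity in the limit: they become
jointly Gaussian with covariance `X = M * Mᵀ`, and the seeds become `He₁ - He₃ / 3`. Wick's rule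
then gives the limiting moments as polynomials in the entries of `X`.

For feasibility, the moments of four distinct indices are expanded by Wick degree across the two
pairs `S` and `T`. The low-degree terms form a Gram matrix; everything else, including the
discrepancy between that Gram matrix and the moment matrix at coinciding indices, has operator norm
at most `α` and is absorbed by the multiple of the identity.
-/

namespace SoSLift

/-! ### Rows of the Sylvester–Hadamard matrix -/

lemma sum_prod_testBit {R : Type*} [CommSemiring R] (f : ℕ → Bool → R) (m : ℕ) :
    ∑ j ∈ Finset.range (2 ^ m), ∏ t ∈ Finset.range m, f t (j.testBit t) =
      ∏ t ∈ Finset.range m, (f t false + f t true) := by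
  induction m with
  | zero => simp
  | succ m ih =>
    rw [pow_succ, mul_two, Finset.sum_range_add, Finset.prod_range_succ, ← ih, mul_add,
      Finset.sum_mul, Finset.sum_mul]
    congr 1 <;> refine Finset.sum_congr rfl fun j hj => ?_ <;>
      have hj := Finset.mem_range.1 hj <;> rw [Finset.prod_range_succ]
    · rw [Nat.testBit_lt_two_pow hj]
    · rw [Nat.testBit_two_pow_add_eq, Nat.testBit_lt_two_pow hj, Bool.not_false]
      congr 1
      refine Finset.prod_congr rfl fun t ht => ?_
      rw [Nat.testBit_two_pow_add_gt (Finset.mem_range.1 ht)]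

lemma eq_of_testBit_eq_of_lt {m a b : ℕ} (ha : a < 2 ^ m) (hb : b < 2 ^ m)
    (h : ∀ t < m, a.testBit t = b.testBit t) : a = b := by
  refine Nat.eq_of_testBit_eq fun t => ?_
  rcases lt_or_ge t m with ht | ht
  · exact h t ht
  · have hm : 2 ^ m ≤ 2 ^ t := Nat.pow_le_pow_right two_pos ht
    rw [Nat.testBit_lt_two_pow (ha.trans_le hm), Nat.testBit_lt_two_pow (hb.trans_le hm)]

lemma sum_hadamard_mul_hadamard {m a b : ℕ} (ha : a < 2 ^ m) (hb : b < 2 ^ m) :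
    ∑ j : Fin (2 ^ m), hadamard m a j * hadamard m b j = if a = b then 1 else 0 := by
  let f (t : ℕ) (e : Bool) : ℝ :=
    (if a.testBit t ∧ e then -1 else 1) * if b.testBit t ∧ e then -1 else 1
  have hf : ∀ j, hadamard m a j * hadamard m b j =
      (∏ t ∈ Finset.range m, f t (j.testBit t)) / 2 ^ m := fun j => by
    rw [hadamard, hadamard, div_mul_div_comm, Real.mul_self_sqrt (by positivity),
      ← Finset.prod_mul_distrib]
  have hsum : ∀ t, f t false + f t true = if a.testBit t = b.testBit t then 2 else 0 := fun t => by
    cases ha : a.testBit t <;> cases hb : b.testBit t <;> norm_num [f, ha, hb]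
  rw [Fin.sum_univ_eq_sum_range (fun j => hadamard m a j * hadamard m b j)]
  simp only [hf, ← Finset.sum_div, sum_prod_testBit, hsum]
  split_ifs with hab
  · simp [hab]
  · obtain ⟨t, ht, hne⟩ : ∃ t < m, a.testBit t ≠ b.testBit t := by
      contrapose! hab
      exact eq_of_testBit_eq_of_lt ha hb hab
    rw [Finset.prod_eq_zero (Finset.mem_range.2 ht) (if_neg hne), zero_div]

lemma abs_hadamard (m a b : ℕ) : |hadamard m a b| = 1 / √(2 ^ m) := by
  rw [hadamard, abs_div, Finset.abs_prod, abs_of_nonneg (Real.sqrt_nonneg _)]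
  congr 1
  refine Finset.prod_eq_one fun t _ => ?_
  split_ifs <;> simp

lemma spread_mul_transpose {n m : ℕ} (M : Matrix (Fin n) (Fin n) ℝ) (h : n ≤ 2 ^ m) :
    spread M m * (spread M m).transpose = M * M.transpose := by
  set H : Matrix (Fin n) (Fin (2 ^ m)) ℝ :=
    Matrix.of fun (k : Fin n) (j : Fin (2 ^ m)) => hadamard m k.val j.val with hH
  have hHH : H * H.transpose = 1 := by
    ext a b
    simp only [Matrix.mul_apply, Matrix.one_apply, hH, Matrix.of_apply, Matrix.transpose_apply,
      sum_hadamard_mul_hadamard (a.2.trans_le h) (b.2.trans_le h), Fin.ext_iff]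
  change M * H * (M * H).transpose = _
  rw [Matrix.transpose_mul, Matrix.mul_assoc, ← Matrix.mul_assoc H, hHH, Matrix.one_mul]

lemma abs_spread_le {n : ℕ} (M : Matrix (Fin n) (Fin n) ℝ) :
    ∃ c : ℝ, 0 ≤ c ∧ ∀ m i j, |spread M m i j| ≤ c / √(2 ^ m) := by
  refine ⟨∑ i, ∑ k, |M i k|, by positivity, fun m i j => ?_⟩
  calc |spread M m i j| ≤ ∑ k, |M i k| * (1 / √(2 ^ m)) := by
        simpa only [spread, Matrix.mul_apply, Matrix.of_apply, abs_mul, abs_hadamard] using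
          Finset.abs_sum_le_sum_abs (fun k => M i k * hadamard m k j) Finset.univ
    _ = (∑ k, |M i k|) / √(2 ^ m) := by rw [← Finset.sum_mul, mul_one_div]
    _ ≤ (∑ i, ∑ k, |M i k|) / √(2 ^ m) := by
        refine div_le_div_of_nonneg_right ?_ (Real.sqrt_nonneg _)
        exact Finset.single_le_sum (f := fun i => ∑ k, |M i k|) (fun _ _ => by positivity)
          (Finset.mem_univ i)

/-! ### Sign vectors -/

lemma six_mul_esymm_three (σ R : Type*) [Fintype σ] [CommRing R] :
    6 * MvPolynomial.esymm σ R 3 = MvPolynomial.psum σ R 1 ^ 3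
      - 3 * MvPolynomial.psum σ R 1 * MvPolynomial.psum σ R 2 + 2 * MvPolynomial.psum σ R 3 := by
  have h₂ : {a ∈ Finset.HasAntidiagonal.antidiagonal 2 | a.1 < 2} = {(0, 2), (1, 1)} := by decide
  have h₃ : {a ∈ Finset.HasAntidiagonal.antidiagonal 3 | a.1 < 3} = {(0, 3), (1, 2), (2, 1)} := by
    decide
  have e₁ : MvPolynomial.esymm σ R 1 = MvPolynomial.psum σ R 1 := by simp
  have e₂ := MvPolynomial.mul_esymm_eq_sum σ R 2
  have e₃ := MvPolynomial.mul_esymm_eq_sum σ R 3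
  rw [h₂] at e₂
  rw [h₃] at e₃
  norm_num [-MvPolynomial.esymm_one, -MvPolynomial.psum_one] at e₂ e₃
  linear_combination 2 * e₃ + MvPolynomial.psum σ R 1 * e₂ +
    (MvPolynomial.psum σ R 1 ^ 2 - 2 * MvPolynomial.psum σ R 2) * e₁

section SignVectors

variable {ι κ : Type*} [Fintype ι] [Fintype κ]

/-- The vector `A z` of Rademacher sums. -/
def radSum (A : Matrix ι κ ℝ) (z : κ → ℤˣ) : ι → ℝ :=
  fun i => ∑ j, A i j * ((z j : ℤ) : ℝ)

lemma intCast_units_sq (u : ℤˣ) : ((u : ℤ) : ℝ) ^ 2 = 1 := by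
  rcases Int.units_eq_one_or u with rfl | rfl <;> simp

lemma abs_intCast_units (u : ℤˣ) : |((u : ℤ) : ℝ)| = 1 := by
  rcases Int.units_eq_one_or u with rfl | rfl <;> simp

lemma expect_exp_sum_le [DecidableEq κ] (a : κ → ℝ) :
    𝔼 z : κ → ℤˣ, Real.exp (∑ j, a j * ((z j : ℤ) : ℝ)) ≤ Real.exp ((∑ j, a j ^ 2) / 2) := by
  have h : 𝔼 z : κ → ℤˣ, Real.exp (∑ j, a j * ((z j : ℤ) : ℝ)) = ∏ j, Real.cosh (a j) := by
    have hcosh : ∀ j, ∑ u : ℤˣ, Real.exp (a j * ((u : ℤ) : ℝ)) = 2 * Real.cosh (a j) := fun j => by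
      simp [UnitsInt.univ, Real.cosh_eq, mul_div_cancel₀]
    simp only [Finset.expect_eq_sum_div_card, Real.exp_sum, ← Fintype.prod_sum
      (fun j (u : ℤˣ) => Real.exp (a j * ((u : ℤ) : ℝ))), hcosh, Finset.prod_mul_distrib,
      Finset.prod_const, Finset.card_univ, Fintype.card_pi, Fintype.card_units_int, Nat.cast_pow,
      Nat.cast_ofNat]
    exact mul_div_cancel_left₀ _ (by positivity)
  rw [h, Finset.sum_div, Real.exp_sum]
  exact Finset.prod_le_prod (fun j _ => (Real.cosh_pos _).le) fun j _ => Real.cosh_le_exp_half_sq _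

lemma one_add_norm_pow_le (N : ℕ) (x : ι → ℝ) :
    (1 + ‖x‖) ^ N ≤
      N.factorial * Real.exp 1 * (1 + ∑ i, (Real.exp (x i) + Real.exp (-x i))) := by
  have hexp : Real.exp ‖x‖ ≤ 1 + ∑ i, (Real.exp (x i) + Real.exp (-x i)) := by
    rw [← Real.le_log_iff_exp_le (by positivity), pi_norm_le_iff_of_nonneg
      (Real.log_nonneg (le_add_of_nonneg_right (by positivity)))]
    intro i
    rw [Real.le_log_iff_exp_le (by positivity), Real.norm_eq_abs]
    calc Real.exp |x i| ≤ Real.exp (x i) + Real.exp (-x i) := Real.exp_abs_le _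
      _ ≤ ∑ i, (Real.exp (x i) + Real.exp (-x i)) :=
        Finset.single_le_sum (f := fun i => Real.exp (x i) + Real.exp (-x i))
          (fun _ _ => by positivity) (Finset.mem_univ i)
      _ ≤ _ := le_add_of_nonneg_left zero_le_one
  have hpow := Real.pow_div_factorial_le_exp (1 + ‖x‖) (by positivity) N
  rw [div_le_iff₀ (by positivity), Real.exp_add] at hpow
  calc _ ≤ Real.exp 1 * Real.exp ‖x‖ * N.factorial := hpow
    _ ≤ Real.exp 1 * (1 + ∑ i, (Real.exp (x i) + Real.exp (-x i))) * N.factorial := by gcongr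
    _ = _ := by ring

lemma expect_one_add_norm_radSum_pow_le (ι : Type*) [Fintype ι] (N : ℕ) :
    ∃ B : ℝ, ∀ (κ : Type) [Fintype κ] [DecidableEq κ] (A : Matrix ι κ ℝ),
      (∀ i, ∑ j, A i j ^ 2 ≤ 1) → 𝔼 z : κ → ℤˣ, (1 + ‖radSum A z‖) ^ N ≤ B := by
  refine ⟨N.factorial * Real.exp 1 * (1 + ∑ _i : ι, (Real.exp (1 / 2) + Real.exp (1 / 2))),
    fun κ _ _ A hA => ?_⟩
  have hpos : ∀ i, 𝔼 z : κ → ℤˣ, Real.exp (radSum A z i) ≤ Real.exp (1 / 2) := fun i =>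
    (expect_exp_sum_le (A i)).trans (Real.exp_le_exp.2 (by linarith [hA i]))
  have hneg : ∀ i, 𝔼 z : κ → ℤˣ, Real.exp (-radSum A z i) ≤ Real.exp (1 / 2) := fun i => by
    have h := expect_exp_sum_le (fun j => -A i j)
    simp only [neg_mul, Finset.sum_neg_distrib, neg_sq] at h
    exact h.trans (Real.exp_le_exp.2 (by linarith [hA i]))
  refine (Finset.expect_le_expect fun z _ => one_add_norm_pow_le N (radSum A z)).trans ?_
  rw [← Finset.mul_expect, Finset.expect_add_distrib, Finset.expect_const Finset.univ_nonempty,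
    Finset.expect_sum_comm]
  simp only [Finset.expect_add_distrib]
  gcongr with i
  exacts [hpos i, hneg i]

end SignVectors

open Filter Topology MvPolynomial

/-! ### Stein's identity -/

section SteinIdentity

variable {ι κ : Type*}

/-- The derivative in the constant direction `h`, as a derivation on polynomials. -/
noncomputable def dirDeriv :
    (ι → ℝ) →ₗ[ℝ] Derivation ℝ (MvPolynomial ι ℝ) (MvPolynomial ι ℝ) :=
  (mkDerivationEquiv ℝ).toLinearMap ∘ₗ (Algebra.linearMap ℝ (MvPolynomial ι ℝ)).compLeft ι

@[simp]
lemma dirDeriv_X (h : ι → ℝ) (i : ι) : dirDeriv h (X i) = C (h i) :=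
  mkDerivation_X _ _ _

section Growth

variable [Fintype ι]

/-- Growth condition `f x h = O((1 + ‖x‖) ^ N * ‖h‖ ^ k)` for some `N`, uniformly in `x` and in
`‖h‖ ≤ 1`: `x` is a base point and `h` a small displacement, and `k` is the order of vanishing
in `h`. -/
def PolyGrowth (k : ℕ) (f : (ι → ℝ) → (ι → ℝ) → ℝ) : Prop :=
  ∃ (K : ℝ) (N : ℕ), 0 ≤ K ∧ ∀ x h, ‖h‖ ≤ 1 → |f x h| ≤ K * (1 + ‖x‖) ^ N * ‖h‖ ^ k

namespace PolyGrowth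

lemma const (c : ℝ) : PolyGrowth 0 fun (_ _ : ι → ℝ) => c :=
  ⟨|c|, 0, abs_nonneg c, fun x h _ => by simp⟩

lemma zero (k : ℕ) : PolyGrowth k fun (_ _ : ι → ℝ) => (0 : ℝ) :=
  ⟨0, 0, le_rfl, fun x h _ => by simp⟩

lemma base (i : ι) : PolyGrowth 0 fun x _ => x i :=
  ⟨1, 1, zero_le_one, fun x h _ => by
    have := norm_le_pi_norm x i
    rw [Real.norm_eq_abs] at this
    simpa using this.trans (le_add_of_nonneg_left zero_le_one)⟩

lemma displacement (i : ι) : PolyGrowth 1 fun _ h => h i :=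
  ⟨1, 0, zero_le_one, fun x h _ => by simpa using norm_le_pi_norm h i⟩

variable {k l : ℕ} {f g : (ι → ℝ) → (ι → ℝ) → ℝ}

lemma of_succ (hf : PolyGrowth (k + 1) f) : PolyGrowth k f := by
  obtain ⟨K, N, hK, hf⟩ := hf
  refine ⟨K, N, hK, fun x h hh => (hf x h hh).trans ?_⟩
  exact mul_le_mul_of_nonneg_left (pow_le_pow_of_le_one (norm_nonneg h) hh k.le_succ)
    (by positivity)

lemma add (hf : PolyGrowth k f) (hg : PolyGrowth k g) :
    PolyGrowth k fun x h => f x h + g x h := by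
  obtain ⟨K, N, hK, hf⟩ := hf
  obtain ⟨L, R, hL, hg⟩ := hg
  refine ⟨K + L, N + R, by positivity, fun x h hh => ?_⟩
  have hx : 1 ≤ 1 + ‖x‖ := le_add_of_nonneg_right (norm_nonneg x)
  calc |f x h + g x h| ≤ K * (1 + ‖x‖) ^ N * ‖h‖ ^ k + L * (1 + ‖x‖) ^ R * ‖h‖ ^ k :=
        (abs_add_le _ _).trans (add_le_add (hf x h hh) (hg x h hh))
    _ ≤ K * (1 + ‖x‖) ^ (N + R) * ‖h‖ ^ k + L * (1 + ‖x‖) ^ (N + R) * ‖h‖ ^ k := by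
        gcongr <;> omega
    _ = (K + L) * (1 + ‖x‖) ^ (N + R) * ‖h‖ ^ k := by ring

lemma mul (hf : PolyGrowth k f) (hg : PolyGrowth l g) :
    PolyGrowth (k + l) fun x h => f x h * g x h := by
  obtain ⟨K, N, hK, hf⟩ := hf
  obtain ⟨L, R, hL, hg⟩ := hg
  refine ⟨K * L, N + R, by positivity, fun x h hh => ?_⟩
  calc |f x h * g x h| ≤ (K * (1 + ‖x‖) ^ N * ‖h‖ ^ k) * (L * (1 + ‖x‖) ^ R * ‖h‖ ^ l) := by
        rw [abs_mul]
        exact mul_le_mul (hf x h hh) (hg x h hh) (abs_nonneg _) (by positivity)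
    _ = K * L * (1 + ‖x‖) ^ (N + R) * ‖h‖ ^ (k + l) := by ring

lemma eval (P : MvPolynomial ι ℝ) : PolyGrowth 0 fun x _ => MvPolynomial.eval x P := by
  induction P using MvPolynomial.induction_on with
  | C a => simpa only [eval_C] using const a
  | add P Q hP hQ => simpa only [map_add] using hP.add hQ
  | mul_X P s hP => simpa only [map_mul, eval_X] using hP.mul (base s)

lemma eval_add_sub_eval (P : MvPolynomial ι ℝ) :
    PolyGrowth 1 fun x h => MvPolynomial.eval (x + h) P - MvPolynomial.eval x P := by
  induction P using MvPolynomial.induction_on with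
  | C a => simpa only [eval_C, sub_self] using zero 1
  | add P Q hP hQ => simpa only [map_add, add_sub_add_comm] using hP.add hQ
  | mul_X P s hP =>
    convert (hP.mul ((base s).add (displacement s).of_succ)).add
      ((eval P).mul (displacement s)) using 3 with x h
    simp only [map_mul, eval_X, Pi.add_apply]
    ring

lemma prod_add_sub_prod (P : ι → MvPolynomial ι ℝ) (s : Finset ι) :
    PolyGrowth 1 fun x h =>
      ∏ i ∈ s, (MvPolynomial.eval x (P i) + h i) - ∏ i ∈ s, MvPolynomial.eval x (P i) := by
  classical
  induction s using Finset.induction_on with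
  | empty => simpa only [Finset.prod_empty, sub_self] using zero 1
  | insert i s hi ih =>
    convert (((eval (P i)).add (displacement i).of_succ).mul ih).add
      ((displacement i).mul (eval (∏ j ∈ s, P j))) using 3 with x h
    rw [Finset.prod_insert hi, Finset.prod_insert hi, map_prod]
    ring

end PolyGrowth

lemma PolyGrowth.eval_add_sub_eval_sub_dirDeriv (P : MvPolynomial ι ℝ) : PolyGrowth 2 fun x h =>
    MvPolynomial.eval (x + h) P - MvPolynomial.eval x P
      - MvPolynomial.eval x (dirDeriv h P) := by
  induction P using MvPolynomial.induction_on with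
  | C a => simpa only [eval_C, derivation_C, map_zero, sub_self] using zero 2
  | add P Q hP hQ =>
    simpa only [map_add, add_sub_add_comm] using hP.add hQ
  | mul_X P s hP =>
    convert (hP.mul (base s)).add ((eval_add_sub_eval P).mul (displacement s)) using 3 with x h
    simp only [map_mul, eval_X, Pi.add_apply, Derivation.leibniz, dirDeriv_X, smul_eq_mul, map_add,
      eval_C]
    ring

lemma PolyGrowth.exists_expect_le {k : ℕ} {f : (ι → ℝ) → (ι → ℝ) → ℝ} (hf : PolyGrowth k f) :
    ∃ L : ℝ, ∀ (κ : Type) [Fintype κ] [DecidableEq κ] (A : Matrix ι κ ℝ),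
      (∀ i, ∑ j, A i j ^ 2 ≤ 1) → ∀ (h : (κ → ℤˣ) → ι → ℝ) (ε : ℝ), ε ≤ 1 →
      (∀ z, ‖h z‖ ≤ ε) → 𝔼 z, |f (radSum A z) (h z)| ≤ L * ε ^ k := by
  obtain ⟨K, N, hK, hf⟩ := hf
  obtain ⟨B, hB⟩ := expect_one_add_norm_radSum_pow_le ι N
  refine ⟨K * B, fun κ _ _ A hA h ε hε hh => ?_⟩
  have hε0 : 0 ≤ ε := (norm_nonneg _).trans (hh 1)
  calc 𝔼 z, |f (radSum A z) (h z)| ≤ 𝔼 z, K * ε ^ k * (1 + ‖radSum A z‖) ^ N :=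
        Finset.expect_le_expect fun z _ => (hf _ _ ((hh z).trans hε)).trans <| by
          rw [mul_right_comm]
          gcongr
          exact hh z
    _ = K * ε ^ k * 𝔼 z : κ → ℤˣ, (1 + ‖radSum A z‖) ^ N := Finset.mul_expect .. |>.symm
    _ ≤ K * ε ^ k * B := by gcongr; exact hB κ A hA
    _ = K * B * ε ^ k := by ring

end Growth

lemma radSum_mul_mulSingle [Fintype κ] [DecidableEq κ] (A : Matrix ι κ ℝ) (z : κ → ℤˣ) (j : κ) :
    radSum A (z * Pi.mulSingle j (-1)) =
      radSum A z + (-2 * ((z j : ℤ) : ℝ)) • fun i => A i j := by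
  funext i
  simp only [radSum, Pi.add_apply, Pi.smul_apply, smul_eq_mul]
  rw [← Finset.sum_erase_add _ _ (Finset.mem_univ j),
    ← Finset.sum_erase_add (a := j) _ _ (Finset.mem_univ j), add_assoc]
  congr 1
  · refine Finset.sum_congr rfl fun k hk => ?_
    simp [Pi.mulSingle_eq_of_ne (Finset.ne_of_mem_erase hk)]
  · simp
    ring

lemma expect_coord_mul [Fintype κ] [DecidableEq κ] (j : κ) (F : (κ → ℤˣ) → ℝ) :
    𝔼 z, ((z j : ℤ) : ℝ) * F z =
      𝔼 z, -((z j : ℤ) : ℝ) / 2 * (F (z * Pi.mulSingle j (-1)) - F z) := by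
  have hflip : 𝔼 z : κ → ℤˣ, -((z j : ℤ) : ℝ) * F (z * Pi.mulSingle j (-1)) =
      𝔼 z : κ → ℤˣ, ((z j : ℤ) : ℝ) * F z :=
    Fintype.expect_equiv (Equiv.mulRight (Pi.mulSingle j (-1))) _ _ fun z => by simp
  have hsplit : 𝔼 z, -((z j : ℤ) : ℝ) / 2 * (F (z * Pi.mulSingle j (-1)) - F z) =
      (𝔼 z : κ → ℤˣ, -((z j : ℤ) : ℝ) * F (z * Pi.mulSingle j (-1)) +
        𝔼 z, ((z j : ℤ) : ℝ) * F z) / 2 := by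
    rw [← Finset.expect_add_distrib, Finset.expect_div]
    exact Finset.expect_congr rfl fun z _ => by ring
  rw [hsplit, hflip]
  ring

lemma abs_expect_coord_mul_sub_le [Finite ι] (P : MvPolynomial ι ℝ) :
    ∃ L : ℝ, ∀ (κ : Type) [Fintype κ] [DecidableEq κ] (A : Matrix ι κ ℝ),
      (∀ i, ∑ j, A i j ^ 2 ≤ 1) → ∀ ε, 0 ≤ ε → ε ≤ 1 / 2 → (∀ i j, |A i j| ≤ ε) → ∀ j,
      |𝔼 z : κ → ℤˣ, ((z j : ℤ) : ℝ) * eval (radSum A z) P -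
        𝔼 z : κ → ℤˣ, eval (radSum A z) (dirDeriv (fun i => A i j) P)| ≤ L * ε ^ 2 := by
  cases nonempty_fintype ι
  obtain ⟨L, hL⟩ := (PolyGrowth.eval_add_sub_eval_sub_dirDeriv P).exists_expect_le
  refine ⟨2 * L, fun κ _ _ A hA ε hε0 hε1 hε j => ?_⟩
  let h (z : κ → ℤˣ) : ι → ℝ := (-2 * ((z j : ℤ) : ℝ)) • fun i => A i j
  have hnorm : ∀ z, ‖h z‖ ≤ 2 * ε := fun z => by
    rw [norm_smul, norm_mul, Real.norm_eq_abs, Real.norm_eq_abs, abs_intCast_units, abs_neg,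
      abs_two, mul_one]
    exact mul_le_mul_of_nonneg_left ((pi_norm_le_iff_of_nonneg hε0).2 fun i => hε i j) zero_le_two
  have hpoint : ∀ z, -((z j : ℤ) : ℝ) / 2 * (eval (radSum A (z * Pi.mulSingle j (-1))) P -
      eval (radSum A z) P) - eval (radSum A z) (dirDeriv (fun i => A i j) P) =
      -((z j : ℤ) : ℝ) / 2 * (eval (radSum A z + h z) P - eval (radSum A z) P -
        eval (radSum A z) (dirDeriv (h z) P)) := fun z => by
    rw [radSum_mul_mulSingle, map_smul, Derivation.smul_apply, smul_eval]
    linear_combination eval (radSum A z) (dirDeriv (fun i => A i j) P) * intCast_units_sq (z j)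
  rw [expect_coord_mul, ← Finset.expect_sub_distrib, Finset.expect_congr rfl fun z _ => hpoint z]
  calc _ ≤ 𝔼 z, |eval (radSum A z + h z) P - eval (radSum A z) P -
        eval (radSum A z) (dirDeriv (h z) P)| / 2 :=
        (Finset.abs_expect_le _ _).trans_eq <| Finset.expect_congr rfl fun z _ => by
          rw [abs_mul, abs_div, abs_neg, abs_intCast_units, abs_two]
          ring
    _ ≤ L * (2 * ε) ^ 2 / 2 := by
        rw [← Finset.expect_div]
        gcongr
        exact hL κ A hA h (2 * ε) (by linarith) hnorm
    _ = 2 * L * ε ^ 2 := by ring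

lemma abs_expect_radSum_mul_sub_le [Finite ι] (P : MvPolynomial ι ℝ) :
    ∃ L : ℝ, ∀ (κ : Type) [Fintype κ] [DecidableEq κ] (A : Matrix ι κ ℝ),
      (∀ i, ∑ j, A i j ^ 2 ≤ 1) → ∀ ε, 0 ≤ ε → ε ≤ 1 / 2 → (∀ i j, |A i j| ≤ ε) → ∀ i,
      |𝔼 z : κ → ℤˣ, eval (radSum A z) (X i * P) -
        𝔼 z : κ → ℤˣ, eval (radSum A z) (dirDeriv ((A * A.transpose) i) P)| ≤
        L * (Fintype.card κ * ε ^ 3) := by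
  obtain ⟨L, hL⟩ := abs_expect_coord_mul_sub_le P
  refine ⟨L, fun κ _ _ A hA ε hε0 hε1 hε i => ?_⟩
  have hcoord : 𝔼 z : κ → ℤˣ, eval (radSum A z) (X i * P) =
      ∑ j, A i j * 𝔼 z : κ → ℤˣ, ((z j : ℤ) : ℝ) * eval (radSum A z) P := by
    simp only [Finset.mul_expect, ← Finset.expect_sum_comm, map_mul, eval_X, radSum,
      Finset.sum_mul, mul_assoc]
  have hderiv : 𝔼 z : κ → ℤˣ, eval (radSum A z) (dirDeriv ((A * A.transpose) i) P) =
      ∑ j, A i j * 𝔼 z : κ → ℤˣ, eval (radSum A z) (dirDeriv (fun s => A s j) P) := by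
    have hrow : (A * A.transpose) i = ∑ j, A i j • fun s => A s j := by
      ext s
      simp [Matrix.mul_apply]
    let D (x : ι → ℝ) : (ι → ℝ) →ₗ[ℝ] ℝ :=
      { toFun := fun v => eval x (dirDeriv v P)
        map_add' := by simp
        map_smul' := by simp [smul_eval] }
    have hD : ∀ x, eval x (dirDeriv ((A * A.transpose) i) P) =
        ∑ j, A i j * eval x (dirDeriv (fun s => A s j) P) := fun x => by
      refine (congrArg (D x) hrow).trans ?_
      simp only [map_sum, map_smul, smul_eq_mul]
      rfl
    simp only [hD, Finset.expect_sum_comm, Finset.mul_expect]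
  rw [hcoord, hderiv, ← Finset.sum_sub_distrib]
  simp only [← mul_sub]
  calc _ ≤ ∑ _j : κ, ε * (L * ε ^ 2) := (Finset.abs_sum_le_sum_abs _ _).trans <|
        Finset.sum_le_sum fun j _ => by
          rw [abs_mul]
          exact mul_le_mul (hε i j) (hL κ A hA ε hε0 hε1 hε j) (abs_nonneg _) hε0
    _ = L * (Fintype.card κ * ε ^ 3) := by simp; ring

/-- Functionals `E a` on polynomials behave along `l` like the expectation over a centered Gaussian
vector with covariance matrix `S`: this is Stein's identity in the limit. -/
structure IsAsymptoticallyGaussian {α : Type*} (l : Filter α)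
    (E : α → MvPolynomial ι ℝ →ₗ[ℝ] ℝ) (S : Matrix ι ι ℝ) : Prop where
  tendsto_one : Tendsto (fun a => E a 1) l (𝓝 1)
  tendsto_stein : ∀ i P, Tendsto (fun a => E a (X i * P) - E a (dirDeriv (S i) P)) l (𝓝 0)

section Spread

variable {n : ℕ} {M S : Matrix (Fin n) (Fin n) ℝ}

/-- The average of a polynomial in the Rademacher sums with coefficient matrix `spread M m`. -/
noncomputable def polyMean (M : Matrix (Fin n) (Fin n) ℝ) (m : ℕ) :
    MvPolynomial (Fin n) ℝ →ₗ[ℝ] ℝ where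
  toFun P := 𝔼 z, eval (radSum (spread M m) z) P
  map_add' P Q := by simp only [map_add, Finset.expect_add_distrib]
  map_smul' a P := by simp only [smul_eval, Finset.mul_expect, RingHom.id_apply, smul_eq_mul]

lemma tendsto_div_sqrt_two_pow (c : ℝ) : Tendsto (fun m : ℕ => c / √(2 ^ m)) atTop (𝓝 0) :=
  (Real.tendsto_sqrt_atTop.comp (tendsto_pow_atTop_atTop_of_one_lt one_lt_two)).const_div_atTop c

lemma eventually_sum_spread_sq (hM : M * M.transpose = S) (hS : ∀ i, S i i = 1) :
    ∀ᶠ m in atTop, spread M m * (spread M m).transpose = S ∧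
      ∀ i, ∑ j, spread M m i j ^ 2 = 1 := by
  filter_upwards [(tendsto_pow_atTop_atTop_of_one_lt (one_lt_two (α := ℕ))).eventually_ge_atTop n]
    with m hm
  have h : spread M m * (spread M m).transpose = S := (spread_mul_transpose M hm).trans hM
  refine ⟨h, fun i => ?_⟩
  rw [← hS i, ← h, Matrix.mul_apply]
  exact Finset.sum_congr rfl fun j _ => sq _

lemma isAsymptoticallyGaussian_polyMean (hM : M * M.transpose = S) (hS : ∀ i, S i i = 1) :
    IsAsymptoticallyGaussian atTop (polyMean M) S where
  tendsto_one := by simp [polyMean]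
  tendsto_stein i P := by
    obtain ⟨L, hL⟩ := abs_expect_radSum_mul_sub_le P
    obtain ⟨c, hc0, hc⟩ := abs_spread_le M
    refine squeeze_zero_norm' ?_
      (by simpa using (tendsto_div_sqrt_two_pow (c ^ 3)).const_mul L)
    filter_upwards [(tendsto_div_sqrt_two_pow c).eventually_le_const (one_half_pos (α := ℝ)),
      eventually_sum_spread_sq hM hS] with m hm ⟨hMS, hrow⟩
    have h := hL _ (spread M m) (fun i => (hrow i).le) _
      (by positivity) hm (hc m) i
    rw [hMS] at h
    refine h.trans_eq ?_
    have hcard : (Fintype.card (Fin (2 ^ m)) : ℝ) = √(2 ^ m) ^ 2 := by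
      rw [Real.sq_sqrt (by positivity), Fintype.card_fin, Nat.cast_pow, Nat.cast_two]
    rw [hcard, div_pow]
    field_simp

end Spread

end SteinIdentity

/-! ### Hermite polynomials and Wick's rule -/

section Hermite

variable {ι : Type*}

lemma derivative_hermite (a : ℕ) :
    (Polynomial.hermite a).derivative = a * Polynomial.hermite (a - 1) := by
  induction a with
  | zero => simp
  | succ a ih =>
    rcases a with - | a
    · simp
    · have h := Polynomial.hermite_succ a
      rw [Polynomial.hermite_succ, Polynomial.derivative_sub, Polynomial.derivative_mul, ih]
      simp only [Polynomial.derivative_X, Polynomial.derivative_mul, Polynomial.derivative_natCast,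
        Nat.add_sub_cancel]
      push_cast
      linear_combination -(a + 1 : Polynomial ℤ) * h

/-- The Hermite polynomial of probability theory of degree `a` in the variable `X i`. -/
noncomputable def hermiteX (i : ι) (a : ℕ) : MvPolynomial ι ℝ :=
  Polynomial.aeval (X i) (Polynomial.hermite a)

lemma hermiteX_zero (i : ι) : hermiteX i 0 = 1 := by simp [hermiteX]

lemma hermiteX_succ (i : ι) (a : ℕ) :
    hermiteX i (a + 1) = X i * hermiteX i a - (a : MvPolynomial ι ℝ) * hermiteX i (a - 1) := by
  simp [hermiteX, derivative_hermite]

lemma dirDeriv_hermiteX (h : ι → ℝ) (i : ι) (a : ℕ) :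
    dirDeriv h (hermiteX i a) = C (a * h i) * hermiteX i (a - 1) := by
  have := ((dirDeriv h).restrictScalars ℤ).map_aeval (Polynomial.hermite a) (X i)
  rw [derivative_hermite] at this
  simp only [Derivation.restrictScalars_apply, dirDeriv_X, smul_eq_mul] at this
  rw [hermiteX, this]
  simp [hermiteX]
  ring

/-- The expectation of `He_a(g₁) He_b(g₂) He_c(g₃) He_d(g₄)` for a centered Gaussian vector with
unit variances and covariances `p₁₂, …, p₃₄`, computed by Wick's rule. -/
def wick {R : Type*} [CommRing R] (p₁₂ p₁₃ p₁₄ p₂₃ p₂₄ p₃₄ : R) : ℕ → ℕ → ℕ → ℕ → R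
  | a + 1, b, c, d =>
      b * p₁₂ * wick p₁₂ p₁₃ p₁₄ p₂₃ p₂₄ p₃₄ a (b - 1) c d +
      c * p₁₃ * wick p₁₂ p₁₃ p₁₄ p₂₃ p₂₄ p₃₄ a b (c - 1) d +
      d * p₁₄ * wick p₁₂ p₁₃ p₁₄ p₂₃ p₂₄ p₃₄ a b c (d - 1)
  | 0, b + 1, c, d =>
      c * p₂₃ * wick p₁₂ p₁₃ p₁₄ p₂₃ p₂₄ p₃₄ 0 b (c - 1) d +
      d * p₂₄ * wick p₁₂ p₁₃ p₁₄ p₂₃ p₂₄ p₃₄ 0 b c (d - 1)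
  | 0, 0, c + 1, d => d * p₃₄ * wick p₁₂ p₁₃ p₁₄ p₂₃ p₂₄ p₃₄ 0 0 c (d - 1)
  | 0, 0, 0, _ + 1 => 0
  | 0, 0, 0, 0 => 1
termination_by a b c d => a + b + c + d

lemma map_wick {R S : Type*} [CommRing R] [CommRing S] (φ : R →+* S)
    (p₁₂ p₁₃ p₁₄ p₂₃ p₂₄ p₃₄ : R) (a b c d : ℕ) :
    φ (wick p₁₂ p₁₃ p₁₄ p₂₃ p₂₄ p₃₄ a b c d) =
      wick (φ p₁₂) (φ p₁₃) (φ p₁₄) (φ p₂₃) (φ p₂₄) (φ p₃₄) a b c d := by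
  fun_induction wick p₁₂ p₁₃ p₁₄ p₂₃ p₂₄ p₃₄ a b c d <;> simp_all [wick]

namespace IsAsymptoticallyGaussian

variable {α : Type*} {l : Filter α} {E : α → MvPolynomial ι ℝ →ₗ[ℝ] ℝ} {S : Matrix ι ι ℝ}

lemma tendsto_hermiteX_succ_mul (hE : IsAsymptoticallyGaussian l E S) {i : ι} (hi : S i i = 1)
    (a : ℕ) {P : MvPolynomial ι ℝ} {v : ℝ}
    (h : Tendsto (fun x => E x (hermiteX i a * dirDeriv (S i) P)) l (𝓝 v)) :
    Tendsto (fun x => E x (hermiteX i (a + 1) * P)) l (𝓝 v) := by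
  have hstein := (hE.tendsto_stein i (hermiteX i a * P)).add h
  rw [zero_add] at hstein
  refine hstein.congr fun x => ?_
  rw [← map_sub, ← map_add]
  congr 1
  simp only [hermiteX_succ, Derivation.leibniz, dirDeriv_hermiteX, hi, smul_eq_mul, mul_one,
    map_natCast]
  ring

lemma tendsto_wick (hE : IsAsymptoticallyGaussian l E S) (hS : ∀ i, S i i = 1) (i j k m : ι)
    (a b c d : ℕ) :
    Tendsto (fun x => E x (hermiteX i a * (hermiteX j b * (hermiteX k c * hermiteX m d)))) l
      (𝓝 (wick (S i j) (S i k) (S i m) (S j k) (S j m) (S k m) a b c d)) := by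
  have hC : ∀ x (r : ℝ) P, E x (C r * P) = r * E x P := fun x r P => by
    rw [← smul_eq_C_mul, map_smul, smul_eq_mul]
  fun_induction wick (S i j) (S i k) (S i m) (S j k) (S j m) (S k m) a b c d with
  | case1 a b c d ihb ihc ihd =>
    refine hE.tendsto_hermiteX_succ_mul (hS i) a ?_
    refine (((ihb.const_mul (b * S i j)).add (ihc.const_mul (c * S i k))).add
      (ihd.const_mul (d * S i m))).congr fun x => ?_
    simp only [← hC, ← map_add, Derivation.leibniz, dirDeriv_hermiteX, smul_eq_mul]
    congr 1
    ring
  | case2 b c d ihc ihd =>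
    simp only [hermiteX_zero, one_mul] at ihc ihd ⊢
    refine hE.tendsto_hermiteX_succ_mul (hS j) b ?_
    refine ((ihc.const_mul (c * S j k)).add (ihd.const_mul (d * S j m))).congr fun x => ?_
    simp only [← hC, ← map_add, Derivation.leibniz, dirDeriv_hermiteX, smul_eq_mul]
    congr 1
    ring
  | case3 c d ihd =>
    simp only [hermiteX_zero, one_mul] at ihd ⊢
    refine hE.tendsto_hermiteX_succ_mul (hS k) c ?_
    refine (ihd.const_mul (d * S k m)).congr fun x => ?_
    simp only [← hC, dirDeriv_hermiteX]
    congr 1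
    ring
  | case4 d =>
    simp only [hermiteX_zero, one_mul]
    simpa using hE.tendsto_hermiteX_succ_mul (hS m) d (P := 1) (v := 0)
      (by simp [tendsto_const_nhds])
  | case5 => simpa only [hermiteX_zero, one_mul] using hE.tendsto_one

end IsAsymptoticallyGaussian

end Hermite

/-! ### Limiting moments of the seed polynomials -/

/-- The limit of the seed polynomials: `(He₁ - He₃ / 3)(X i)`. -/
noncomputable def hermiteSeed {ι : Type*} (i : ι) : MvPolynomial ι ℝ :=
  hermiteX i 1 - C (1 / 3) * hermiteX i 3

lemma eval_hermiteSeed {ι : Type*} (x : ι → ℝ) (i : ι) :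
    eval x (hermiteSeed i) = 2 * x i - x i ^ 3 / 3 := by
  simp [hermiteSeed, hermiteX_succ, hermiteX_zero]
  ring

section Limits

variable {n : ℕ} {M S : Matrix (Fin n) (Fin n) ℝ}

lemma seed_eq {κ : ℕ} {A : Matrix (Fin n) (Fin κ) ℝ} {i : Fin n} (hA : ∑ j, A i j ^ 2 = 1)
    (z : Fin κ → ℤˣ) :
    seed A i z = eval (radSum A z) (hermiteSeed i) +
      -(2 / 3) * ∑ j, (A i j * ((z j : ℤ) : ℝ)) ^ 3 := by
  have h := congrArg (aeval fun j => A i j * ((z j : ℤ) : ℝ)) (six_mul_esymm_three (Fin κ) ℝ)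
  simp only [esymm, psum, map_mul, map_sub, map_add, map_sum, map_pow, map_prod, map_ofNat,
    aeval_X, pow_one, mul_pow _ _ 2, intCast_units_sq, mul_one, hA] at h
  rw [eval_hermiteSeed, seed, radSum]
  linear_combination -h / 3

lemma abs_sum_pow_three_le {κ : Type*} [Fintype κ] {a : κ → ℝ} {ε : ℝ} (ha : ∑ j, a j ^ 2 = 1)
    (hε : ∀ j, |a j| ≤ ε) : |∑ j, a j ^ 3| ≤ ε :=
  calc |∑ j, a j ^ 3| ≤ ∑ j, ε * a j ^ 2 := (Finset.abs_sum_le_sum_abs _ _).trans <|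
        Finset.sum_le_sum fun j _ => by
          rw [pow_succ', abs_mul, abs_of_nonneg (sq_nonneg (a j))]
          exact mul_le_mul_of_nonneg_right (hε j) (sq_nonneg _)
    _ = ε := by rw [← Finset.mul_sum, ha, mul_one]

lemma tendsto_seedMoment_sub (hM : M * M.transpose = S) (hS : ∀ i, S i i = 1)
    (U : Finset (Fin n)) :
    Tendsto (fun m => seedMoment M U m - polyMean M m (∏ i ∈ U, hermiteSeed i)) atTop (𝓝 0) := by
  obtain ⟨L, hL⟩ := (PolyGrowth.prod_add_sub_prod hermiteSeed U).exists_expect_le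
  obtain ⟨c, hc0, hc⟩ := abs_spread_le M
  refine squeeze_zero_norm' ?_ (by simpa using (tendsto_div_sqrt_two_pow c).const_mul L)
  filter_upwards [(tendsto_div_sqrt_two_pow c).eventually_le_const one_pos,
    eventually_sum_spread_sq hM hS] with m hm ⟨_, hrow⟩
  let h (z : Fin (2 ^ m) → ℤˣ) (i : Fin n) : ℝ :=
    -(2 / 3) * ∑ j, (spread M m i j * ((z j : ℤ) : ℝ)) ^ 3
  have hh : ∀ z, ‖h z‖ ≤ c / √(2 ^ m) := fun z =>
      (pi_norm_le_iff_of_nonneg (by positivity)).2 fun i => by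
    have h3 := abs_sum_pow_three_le (a := fun j => spread M m i j * ((z j : ℤ) : ℝ))
      (by simpa only [mul_pow, intCast_units_sq, mul_one] using hrow i)
      (fun j => by simpa only [abs_mul, abs_intCast_units, mul_one] using hc m i j)
    rw [Real.norm_eq_abs, abs_mul, abs_neg, abs_of_pos (by norm_num : (0 : ℝ) < 2 / 3)]
    exact (mul_le_of_le_one_left (abs_nonneg _) (by norm_num)).trans h3
  have hmean := hL _ (spread M m) (fun i => (hrow i).le) h _ hm hh
  rw [pow_one] at hmean
  refine le_trans ?_ hmean
  rw [seedMoment]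
  simp only [polyMean, LinearMap.coe_mk, AddHom.coe_mk, map_prod, ← Finset.expect_sub_distrib,
    seed_eq (hrow _), Real.norm_eq_abs]
  exact Finset.abs_expect_le _ _

lemma seed_neg {κ : ℕ} (A : Matrix (Fin n) (Fin κ) ℝ) (i : Fin n) (z : Fin κ → ℤˣ) :
    seed A i (-z) = -seed A i z := by
  have hlin : ∀ j, A i j * (((-z) j : ℤ) : ℝ) = -(A i j * ((z j : ℤ) : ℝ)) := fun j => by simp
  have hcub : ∀ J ∈ Finset.powersetCard 3 (Finset.univ : Finset (Fin κ)),
      ∏ j ∈ J, -(A i j * ((z j : ℤ) : ℝ)) = -∏ j ∈ J, A i j * ((z j : ℤ) : ℝ) := fun J hJ => by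
    rw [Finset.prod_neg, (Finset.mem_powersetCard.1 hJ).2]
    ring
  simp only [seed, hlin, Finset.sum_congr rfl hcub, Finset.sum_neg_distrib]
  ring

lemma seedMoment_eq_zero_of_odd (M : Matrix (Fin n) (Fin n) ℝ) {U : Finset (Fin n)}
    (hU : Odd U.card) (m : ℕ) : seedMoment M U m = 0 := by
  have h : seedMoment M U m = -seedMoment M U m := by
    rw [seedMoment, ← Finset.expect_neg_distrib]
    refine Fintype.expect_equiv (Equiv.neg _) _ _ fun z => ?_
    simp only [Equiv.neg_apply, seed_neg]
    rw [Finset.prod_neg, hU.neg_one_pow]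
    ring
  linarith

end Limits

/-- The functional sending the Hermite polynomial of degree `a` to `f a`, applied to the limiting
seed polynomial. -/
def seedComb {R : Type*} [CommRing R] [Algebra ℚ R] (f : ℕ → R) : R :=
  f 1 - algebraMap ℚ R (1 / 3) * f 3

/-- The limiting moment of four seed polynomials, as a polynomial in the covariances. -/
def quartMoment {R : Type*} [CommRing R] [Algebra ℚ R] (p₁₂ p₁₃ p₁₄ p₂₃ p₂₄ p₃₄ : R) : R :=
  seedComb fun a => seedComb fun b => seedComb fun c => seedComb fun d =>
    wick p₁₂ p₁₃ p₁₄ p₂₃ p₂₄ p₃₄ a b c d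

lemma map_quartMoment {R S : Type*} [CommRing R] [CommRing S] [Algebra ℚ R] [Algebra ℚ S]
    (φ : R →ₐ[ℚ] S) (p₁₂ p₁₃ p₁₄ p₂₃ p₂₄ p₃₄ : R) :
    φ (quartMoment p₁₂ p₁₃ p₁₄ p₂₃ p₂₄ p₃₄) =
      quartMoment (φ p₁₂) (φ p₁₃) (φ p₁₄) (φ p₂₃) (φ p₂₄) (φ p₃₄) := by
  have h := map_wick (φ : R →+* S) p₁₂ p₁₃ p₁₄ p₂₃ p₂₄ p₃₄
  simp only [RingHom.coe_coe] at h
  simp only [quartMoment, seedComb, map_sub, map_mul, h, AlgHom.commutes]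

/-- The limiting moment of two seed polynomials, as a function of the covariance. -/
noncomputable def pairMoment (p : ℝ) : ℝ := p + 2 / 3 * p ^ 3

lemma tendsto_seedComb {ι α : Type*} {l : Filter α} {E : α → MvPolynomial ι ℝ →ₗ[ℝ] ℝ}
    {F : ℕ → MvPolynomial ι ℝ} {g : ℕ → ℝ} (h : ∀ a, Tendsto (fun m => E m (F a)) l (𝓝 (g a))) :
    Tendsto (fun m => E m (F 1 - C (1 / 3) * F 3)) l (𝓝 (seedComb g)) := by
  simpa [seedComb, ← smul_eq_C_mul] using (h 1).sub ((h 3).const_mul 3⁻¹)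

section Limits

variable {n : ℕ} {M S : Matrix (Fin n) (Fin n) ℝ}

lemma tendsto_seedMoment_quart (hM : M * M.transpose = S) (hS : ∀ i, S i i = 1)
    (e : Fin 4 ↪ Fin n) :
    Tendsto (seedMoment M (Finset.univ.map e)) atTop
      (𝓝 (quartMoment (S (e 0) (e 1)) (S (e 0) (e 2)) (S (e 0) (e 3)) (S (e 1) (e 2))
        (S (e 1) (e 3)) (S (e 2) (e 3)))) := by
  have hwick := tendsto_seedComb fun a => tendsto_seedComb fun b => tendsto_seedComb fun c =>
    tendsto_seedComb fun d =>
      (isAsymptoticallyGaussian_polyMean hM hS).tendsto_wick hS (e 0) (e 1) (e 2) (e 3) a b c d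
  have hlim := (tendsto_seedMoment_sub hM hS (Finset.univ.map e)).add hwick
  rw [zero_add] at hlim
  refine hlim.congr fun m => ?_
  rw [sub_add_eq_add_sub, add_sub_assoc, add_eq_left, sub_eq_zero, Finset.prod_map,
    Fin.prod_univ_four]
  congr 1
  simp only [hermiteSeed]
  ring

lemma tendsto_seedMoment_pair (hM : M * M.transpose = S) (hS : ∀ i, S i i = 1)
    (e : Fin 2 ↪ Fin n) :
    Tendsto (seedMoment M (Finset.univ.map e)) atTop (𝓝 (pairMoment (S (e 0) (e 1)))) := by
  have hwick := tendsto_seedComb fun a => tendsto_seedComb fun b =>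
    (isAsymptoticallyGaussian_polyMean hM hS).tendsto_wick hS (e 0) (e 1) (e 0) (e 1) a b 0 0
  have hlim := (tendsto_seedMoment_sub hM hS (Finset.univ.map e)).add hwick
  convert hlim using 2 with m
  · rw [sub_add_eq_add_sub, add_sub_assoc, left_eq_add, sub_eq_zero, Finset.prod_map,
      Fin.prod_univ_two]
    congr 1
    simp only [hermiteSeed, hermiteX_zero]
    ring
  · simp [seedComb, wick, pairMoment]
    ring

end Limits

/-! ### The moment matrix -/

/-- The limiting moments of the seed polynomials of `k` distinct indices, as polynomials in the
covariances. They vanish for odd `k`; the value `0` for even `k ≥ 6` is immaterial, as a symmetric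
difference of two sets of size at most two has at most four elements. -/
noncomputable def momentPoly : (k : ℕ) → MvPolynomial (Fin k × Fin k) ℚ
  | 0 => 1
  | 2 => X (0, 1) + C (2 / 3) * X (0, 1) ^ 3
  | 4 => quartMoment (X (0, 1)) (X (0, 2)) (X (0, 3)) (X (1, 2)) (X (1, 3)) (X (2, 3))
  | _ => 0

section MomentMatrix

variable {n : ℕ} {S : Matrix (Fin n) (Fin n) ℝ}

lemma tendsto_seedMoment {M : Matrix (Fin n) (Fin n) ℝ} (hM : M * M.transpose = S)
    (hS : ∀ i, S i i = 1) {k : ℕ} (hk : k ≤ 4) (e : Fin k ↪ Fin n) :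
    Tendsto (seedMoment M (Finset.univ.map e)) atTop
      (𝓝 (aeval (fun p : Fin k × Fin k => S (e p.1) (e p.2)) (momentPoly k))) := by
  have hodd (ho : Odd k) : Tendsto (seedMoment M (Finset.univ.map e)) atTop (𝓝 0) := by
    rw [funext (seedMoment_eq_zero_of_odd M (by simpa using ho))]
    exact tendsto_const_nhds
  interval_cases k
  · have h : seedMoment M (Finset.univ.map e) = fun _ => 1 := by
      funext m
      simp [seedMoment]
    rw [h]
    simp [momentPoly]
  · simpa [momentPoly] using hodd (by decide)
  · simpa [momentPoly, pairMoment] using tendsto_seedMoment_pair hM hS e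
  · simpa [momentPoly] using hodd (by decide)
  · simpa [momentPoly, map_quartMoment] using tendsto_seedMoment_quart hM hS e

open scoped MatrixOrder in
lemma exists_mul_transpose_eq {ι : Type*} [Fintype ι] {S : Matrix ι ι ℝ}
    (hS : S.PosSemidef) : ∃ M : Matrix ι ι ℝ, M * M.transpose = S := by
  classical
  have h : (CFC.sqrt S).transpose = CFC.sqrt S := (CFC.sqrt_nonneg S).isSelfAdjoint
  exact ⟨CFC.sqrt S, by rw [h]; exact CFC.sqrt_mul_sqrt_self S hS.nonneg⟩

lemma factor_mul_transpose (hS : S.PosSemidef) : factor S * (factor S).transpose = S := by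
  have h := exists_mul_transpose_eq hS
  rw [factor, dif_pos h]
  exact h.choose_spec

lemma card_symmDiff_le (I J : Idx n) : (I.1 ∆ J.1).card ≤ 4 := by
  have hsub : I.1 ∆ J.1 ⊆ I.1 ∪ J.1 := symmDiff_le_sup
  have := (Finset.card_le_card hsub).trans (Finset.card_union_le _ _)
  have := I.2
  have := J.2
  omega

lemma momentMatrix_eq (hS : S ∈ SoS2 n) {I J : Idx n} {k : ℕ} {e : Fin k ↪ Fin n}
    (he : Finset.univ.map e = I.1 ∆ J.1) :
    momentMatrix S I J =
      aeval (fun p : Fin k × Fin k => S (e p.1) (e p.2)) (momentPoly k) := by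
  have hk : k ≤ 4 := by simpa [← he] using card_symmDiff_le I J
  have h := (tendsto_seedMoment (factor_mul_transpose hS.1) hS.2 hk e).limUnder_eq
  rwa [he] at h

lemma tendsto_momentMatrix (hS : S ∈ SoS2 n) {M : Matrix (Fin n) (Fin n) ℝ}
    (hM : M * M.transpose = S) (I J : Idx n) :
    Tendsto (seedMoment M (I.1 ∆ J.1)) atTop (𝓝 (momentMatrix S I J)) := by
  have he := Finset.map_orderEmbOfFin_univ (I.1 ∆ J.1) rfl
  have h := tendsto_seedMoment hM hS.2 (card_symmDiff_le I J)
    ((I.1 ∆ J.1).orderEmbOfFin rfl).toEmbedding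
  rwa [← momentMatrix_eq hS he, he] at h

lemma momentMatrix_self (hS : S ∈ SoS2 n) (I : Idx n) : momentMatrix S I I = 1 := by
  rw [momentMatrix_eq hS (e := (⟨Fin.elim0, fun a => a.elim0⟩ : Fin 0 ↪ Fin n)) (by simp)]
  simp [momentPoly]

lemma momentMatrix_pair (hS : S ∈ SoS2 n) {I J : Idx n} {i j : Fin n} (hij : i ≠ j)
    (h : I.1 ∆ J.1 = {i, j}) : momentMatrix S I J = pairMoment (S i j) := by
  have hinj : Function.Injective ![i, j] := by
    intro a b
    fin_cases a <;> fin_cases b <;> simp [hij, hij.symm]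
  have he : Finset.univ.map ⟨![i, j], hinj⟩ = I.1 ∆ J.1 := by
    rw [h]; ext; simp [Fin.exists_fin_two, eq_comm]
  simp [momentMatrix_eq hS he, momentPoly, pairMoment]

lemma momentMatrix_quart (hS : S ∈ SoS2 n) {I J : Idx n} {i j k l : Fin n} (hij : i ≠ j)
    (hik : i ≠ k) (hil : i ≠ l) (hjk : j ≠ k) (hjl : j ≠ l) (hkl : k ≠ l)
    (h : I.1 ∆ J.1 = {i, j, k, l}) :
    momentMatrix S I J = quartMoment (S i j) (S i k) (S i l) (S j k) (S j l) (S k l) := by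
  have hinj : Function.Injective ![i, j, k, l] := by
    intro a b
    fin_cases a <;> fin_cases b <;>
      simp [hij, hij.symm, hik, hik.symm, hil, hil.symm, hjk, hjk.symm, hjl, hjl.symm, hkl,
        hkl.symm]
  have he : Finset.univ.map ⟨![i, j, k, l], hinj⟩ = I.1 ∆ J.1 := by
    rw [h]; ext; simp [Fin.exists_fin_succ, eq_comm]
  simp [momentMatrix_eq hS he, momentPoly, map_quartMoment]

lemma momentMatrix_odd (hS : S ∈ SoS2 n) {I J : Idx n} (h : Odd (I.1 ∆ J.1).card) :
    momentMatrix S I J = 0 := by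
  refine tendsto_nhds_unique (tendsto_momentMatrix hS (factor_mul_transpose hS.1) I J) ?_
  rw [funext (seedMoment_eq_zero_of_odd (factor S) h)]
  exact tendsto_const_nhds

end MomentMatrix

/-! ### Operator norms of matrices -/

section OperatorNorm

open Matrix
open scoped Matrix.Norms.L2Operator Kronecker

variable {ι κ ι' κ' : Type*} [Fintype ι] [Fintype κ] [DecidableEq κ]

lemma l2_opNorm_le_of_sum_sq_le {A : Matrix ι κ ℝ} {a : ℝ} (ha : 0 ≤ a)
    (h : ∀ v : κ → ℝ, ∑ i, (A *ᵥ v) i ^ 2 ≤ a ^ 2 * ∑ j, v j ^ 2) : ‖A‖ ≤ a := by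
  rw [l2_opNorm_def]
  refine ContinuousLinearMap.opNorm_le_bound _ ha fun v => ?_
  refine (sq_le_sq₀ (norm_nonneg _) (by positivity)).1 ?_
  rw [mul_pow, EuclideanSpace.norm_sq_eq, EuclideanSpace.norm_sq_eq]
  simpa only [Real.norm_eq_abs, sq_abs] using! h v

lemma sum_mulVec_sq_le (A : Matrix ι κ ℝ) (v : κ → ℝ) :
    ∑ i, (A *ᵥ v) i ^ 2 ≤ ‖A‖ ^ 2 * ∑ j, v j ^ 2 := by
  have h := pow_le_pow_left₀ (norm_nonneg _) (l2_opNorm_mulVec A (WithLp.toLp 2 v)) 2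
  rw [mul_pow, EuclideanSpace.norm_sq_eq, EuclideanSpace.norm_sq_eq] at h
  simpa using h

lemma l2_opNorm_le_of_abs_le_mul {A f g : Matrix ι κ ℝ} {δ R : ℝ} (hδ : 0 ≤ δ) (hR : 0 ≤ R)
    (hA : ∀ i j, |A i j| ≤ δ * (|f i j| * |g i j|)) (hf : ∀ i, ∑ j, f i j ^ 2 ≤ R)
    (hg : ∀ j, ∑ i, g i j ^ 2 ≤ R) : ‖A‖ ≤ δ * R := by
  refine l2_opNorm_le_of_sum_sq_le (by positivity) fun v => ?_
  have hrow : ∀ i, (A *ᵥ v) i ^ 2 ≤ δ ^ 2 * R * ∑ j, g i j ^ 2 * v j ^ 2 := fun i => by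
    have habs : |(A *ᵥ v) i| ≤ δ * ∑ j, |f i j| * |g i j * v j| := by
      rw [Finset.mul_sum]
      refine (Finset.abs_sum_le_sum_abs _ _).trans (Finset.sum_le_sum fun j _ => ?_)
      rw [abs_mul, abs_mul, ← mul_assoc, ← mul_assoc]
      exact mul_le_mul_of_nonneg_right ((hA i j).trans_eq (mul_assoc _ _ _).symm) (abs_nonneg _)
    have hcs := Finset.sum_mul_sq_le_sq_mul_sq Finset.univ (fun j => |f i j|)
      fun j => |g i j * v j|
    simp only [sq_abs, mul_pow] at hcs
    calc (A *ᵥ v) i ^ 2 ≤ (δ * ∑ j, |f i j| * |g i j * v j|) ^ 2 := sq_le_sq' (by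
            linarith [neg_abs_le ((A *ᵥ v) i)]) ((le_abs_self _).trans habs)
      _ ≤ δ ^ 2 * (R * ∑ j, g i j ^ 2 * v j ^ 2) := by
          rw [mul_pow]
          gcongr
          exact hcs.trans (mul_le_mul_of_nonneg_right (hf i) (by positivity))
      _ = _ := by ring
  calc ∑ i, (A *ᵥ v) i ^ 2 ≤ ∑ i, δ ^ 2 * R * ∑ j, g i j ^ 2 * v j ^ 2 :=
        Finset.sum_le_sum fun i _ => hrow i
    _ = δ ^ 2 * R * ∑ j, (∑ i, g i j ^ 2) * v j ^ 2 := by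
        rw [← Finset.mul_sum, Finset.sum_comm]
        simp only [Finset.sum_mul]
    _ ≤ δ ^ 2 * R * ∑ j, R * v j ^ 2 := by
        gcongr with j _
        exact hg j
    _ = (δ * R) ^ 2 * ∑ j, v j ^ 2 := by rw [← Finset.mul_sum]; ring

lemma l2_opNorm_submatrix_le [Fintype ι'] [Fintype κ'] [DecidableEq κ'] (A : Matrix ι κ ℝ)
    {f : ι' → ι} {g : κ' → κ} (hf : f.Injective) (hg : g.Injective) : ‖A.submatrix f g‖ ≤ ‖A‖ := by
  refine l2_opNorm_le_of_sum_sq_le (norm_nonneg _) fun v => ?_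
  have hinj (F : κ → ℝ) (hF : ∀ b ∉ Set.range g, F b = 0) : ∑ b, F (g b) = ∑ b, F b :=
    Finset.sum_of_injOn g hg.injOn (by simp) (fun b _ hb => hF b (by simpa using hb)) fun _ _ => rfl
  have hext : ∀ b ∉ Set.range g, g.extend v 0 b = 0 := fun b hb =>
    Function.extend_apply' v _ b hb
  have hrow : ∀ a, (A.submatrix f g *ᵥ v) a = (A *ᵥ g.extend v 0) (f a) := fun a => by
    simp only [mulVec, dotProduct, submatrix_apply]
    rw [← hinj _ fun b hb => by rw [hext b hb, mul_zero]]
    simp only [hg.extend_apply]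
  have hnorm : ∑ b, v b ^ 2 = ∑ b, g.extend v 0 b ^ 2 := by
    rw [← hinj _ fun b hb => by rw [hext b hb, sq, mul_zero]]
    simp only [hg.extend_apply]
  calc ∑ a, (A.submatrix f g *ᵥ v) a ^ 2 = ∑ a, (A *ᵥ g.extend v 0) (f a) ^ 2 := by simp only [hrow]
    _ ≤ ∑ i, (A *ᵥ g.extend v 0) i ^ 2 := by
        classical
        rw [← Finset.sum_image (g := f) (f := fun i => (A *ᵥ g.extend v 0) i ^ 2) hf.injOn]
        exact Finset.sum_le_univ_sum_of_nonneg fun i => sq_nonneg _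
    _ ≤ ‖A‖ ^ 2 * ∑ b, v b ^ 2 := by rw [hnorm]; exact sum_mulVec_sq_le A _

lemma l2_opNorm_one_kronecker_le [DecidableEq ι] (A : Matrix κ κ ℝ) :
    ‖(1 : Matrix ι ι ℝ) ⊗ₖ A‖ ≤ ‖A‖ := by
  refine l2_opNorm_le_of_sum_sq_le (norm_nonneg _) fun v => ?_
  have hrow : ∀ i j, (((1 : Matrix ι ι ℝ) ⊗ₖ A) *ᵥ v) (i, j) = (A *ᵥ fun b => v (i, b)) j :=
    fun i j => by simp [mulVec, dotProduct, Fintype.sum_prod_type, one_apply]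
  rw [Fintype.sum_prod_type, Fintype.sum_prod_type, Finset.mul_sum]
  simp only [hrow]
  exact Finset.sum_le_sum fun i _ => sum_mulVec_sq_le A _

lemma posSemidef_add_smul_one {A : Matrix κ κ ℝ} {a : ℝ} (hA : A.IsHermitian) (ha : ‖A‖ ≤ a) :
    (A + a • (1 : Matrix κ κ ℝ)).PosSemidef := by
  refine .of_dotProduct_mulVec_nonneg (hA.add ?_) fun v => ?_
  · simp [IsHermitian]
  have hsq : (v ⬝ᵥ A *ᵥ v) ^ 2 ≤ (a * ∑ j, v j ^ 2) ^ 2 := calc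
    (v ⬝ᵥ A *ᵥ v) ^ 2 ≤ (∑ j, v j ^ 2) * ∑ j, (A *ᵥ v) j ^ 2 := Finset.sum_mul_sq_le_sq_mul_sq _ _ _
    _ ≤ (∑ j, v j ^ 2) * (a ^ 2 * ∑ j, v j ^ 2) := by
        gcongr
        exact (sum_mulVec_sq_le A v).trans (by gcongr)
    _ = (a * ∑ j, v j ^ 2) ^ 2 := by ring
  have hpos : 0 ≤ a * ∑ j, v j ^ 2 := mul_nonneg ((norm_nonneg A).trans ha) (by positivity)
  have hexpand : star v ⬝ᵥ (A + a • (1 : Matrix κ κ ℝ)) *ᵥ v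
      = v ⬝ᵥ A *ᵥ v + a * ∑ j, v j ^ 2 := by
    simp [add_mulVec, smul_mulVec, dotProduct, sq, mul_add, Finset.sum_add_distrib, Finset.mul_sum,
      mul_left_comm]
  linarith [neg_le_of_abs_le (abs_le_of_sq_le_sq hsq hpos)]

lemma posSemidef_fromBlocks_zero {ι κ : Type*} [Finite ι] [Finite κ] {A : Matrix ι ι ℝ}
    {D : Matrix κ κ ℝ} (hA : A.PosSemidef) (hD : D.PosSemidef) :
    (fromBlocks A 0 0 D).PosSemidef := by
  cases nonempty_fintype ι
  cases nonempty_fintype κ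
  refine .of_dotProduct_mulVec_nonneg (hA.1.fromBlocks (by simp) hD.1) fun v => ?_
  have h := add_nonneg (hA.dotProduct_mulVec_nonneg (v ∘ Sum.inl))
    (hD.dotProduct_mulVec_nonneg (v ∘ Sum.inr))
  simpa [fromBlocks_mulVec, dotProduct] using h

end OperatorNorm

/-! ### The degree-two block: expansion of the entries -/

section Expansion

/-- The terms of `quartMoment` of Wick degree at most two across the pairs `{1, 2}` and `{3, 4}`
(the powers of `p₁₂` and `p₃₄` do not count). -/
noncomputable def lowPart (p₁₂ p₁₃ p₁₄ p₂₃ p₂₄ p₃₄ : ℝ) : ℝ :=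
  pairMoment p₁₂ * pairMoment p₃₄ +
    ((1 + 2 * p₁₂ ^ 2) * (1 + 2 * p₃₄ ^ 2) * (p₁₃ * p₂₄ + p₁₄ * p₂₃)
      - 2 * p₃₄ * (1 + 2 * p₁₂ ^ 2) * (p₁₃ * p₂₃ + p₁₄ * p₂₄)
      - 2 * p₁₂ * (1 + 2 * p₃₄ ^ 2) * (p₁₃ * p₁₄ + p₂₃ * p₂₄)
      + 2 * p₁₂ * p₃₄ * (p₁₃ ^ 2 + p₁₄ ^ 2 + p₂₃ ^ 2 + p₂₄ ^ 2))

/-- The terms of `quartMoment` of Wick degree at least four across the pairs `{1, 2}` and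
`{3, 4}`, up to the exchanges of `1` with `2` and of `3` with `4`. -/
noncomputable def highTerm (p₁₂ p₁₃ p₁₄ p₂₃ p₂₄ p₃₄ : ℝ) : ℝ :=
  2 / 3 * (p₁₃ ^ 3 * p₂₄) + 2 * (p₁₃ ^ 2 * p₁₄ * p₂₃)
    - 4 * (p₃₄ * p₁₄ ^ 2 * p₁₃ * p₂₃) - 4 * (p₁₂ * p₂₃ ^ 2 * p₁₃ * p₁₄)
    + (2 * (p₁₂ * p₃₄) + 2 / 9 * (p₁₃ * p₂₄) + 2 * (p₁₄ * p₂₃)) * (p₁₃ * p₂₄) ^ 2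
    + 4 * (p₁₂ * p₃₄ * p₁₃ * p₂₄ * p₁₄ * p₂₃)

lemma quartMoment_eq (p₁₂ p₁₃ p₁₄ p₂₃ p₂₄ p₃₄ : ℝ) :
    quartMoment p₁₂ p₁₃ p₁₄ p₂₃ p₂₄ p₃₄ = lowPart p₁₂ p₁₃ p₁₄ p₂₃ p₂₄ p₃₄ +
      (highTerm p₁₂ p₁₃ p₁₄ p₂₃ p₂₄ p₃₄ + highTerm p₁₂ p₂₃ p₂₄ p₁₃ p₁₄ p₃₄
        + highTerm p₁₂ p₁₄ p₁₃ p₂₄ p₂₃ p₃₄ + highTerm p₁₂ p₂₄ p₂₃ p₁₄ p₁₃ p₃₄) := by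
  simp [quartMoment, seedComb, wick, lowPart, highTerm, pairMoment]
  ring

/-- The factor of the second term of `commonTerm`. -/
noncomputable def commonFactor (a b c : ℝ) : ℝ :=
  4 / 3 * (a * a) + 4 / 3 * (b * b) + 80 / 9 * ((a * a) * (b * b)) + 4 * (c * c) - 12 * (a * b * c)

/-- What the formula for `quartMoment` misses for two pairs `{i, j}` and `{i, l}` with `j ≠ l`, as a
function of the covariances `a = X i j`, `b = X i l`, `c = X j l`. -/
noncomputable def commonTerm (a b c : ℝ) : ℝ := 2 / 3 * c ^ 3 - a * b * commonFactor a b c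

lemma pairMoment_eq (a b c : ℝ) :
    pairMoment c = lowPart a 1 b a c b +
      (highTerm a 0 b a c b + highTerm a a c 0 b b + highTerm a b 0 c a b + highTerm a c a b 0 b)
      + commonTerm a b c := by
  simp only [pairMoment, lowPart, highTerm, commonTerm, commonFactor]
  ring

/-- What the formula for `quartMoment` and the correction `commonTerm` miss for two equal pairs of
covariance `a`. -/
noncomputable def diagTerm (a : ℝ) : ℝ := -a ^ 2 * (2 - 20 / 3 * a ^ 2 - 80 / 9 * a ^ 4)

lemma one_eq_lowPart_add (a : ℝ) :
    1 = lowPart a 1 a a 1 a + (highTerm a 0 a a 0 a + highTerm a a 0 0 a a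
      + highTerm a a 0 0 a a + highTerm a 0 a a 0 a) + 2 * commonTerm a a 0 + diagTerm a := by
  simp only [pairMoment, lowPart, highTerm, commonTerm, commonFactor, diagTerm]
  ring

section Bounds

variable {a b c δ : ℝ}

lemma abs_mul_le_of_le_one (hδ : δ ≤ 1) (ha : |a| ≤ δ) (hb : |b| ≤ δ) : |a * b| ≤ δ := by
  rw [abs_mul]
  exact (mul_le_of_le_one_right (abs_nonneg _) (hb.trans hδ)).trans ha

lemma abs_commonFactor_le (hδ : δ ≤ 1) (ha : |a| ≤ δ) (hb : |b| ≤ δ) (hc : |c| ≤ δ) :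
    |commonFactor a b c| ≤ 28 * δ := by
  have haa := abs_mul_le_of_le_one hδ ha ha
  have hbb := abs_mul_le_of_le_one hδ hb hb
  have haabb := abs_le.1 (abs_mul_le_of_le_one hδ haa hbb)
  have hcc := abs_le.1 (abs_mul_le_of_le_one hδ hc hc)
  have habc := abs_le.1 (abs_mul_le_of_le_one hδ (abs_mul_le_of_le_one hδ ha hb) hc)
  rw [abs_le] at haa hbb ⊢
  rw [commonFactor]
  constructor <;> linarith

lemma abs_diagTerm_le (hδ : δ ≤ 1) (ha : |a| ≤ δ) : |diagTerm a| ≤ 18 * δ := by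
  have haa := abs_mul_le_of_le_one hδ ha ha
  have h₄ := abs_mul_le_of_le_one hδ haa haa
  have h₆ := abs_le.1 (abs_mul_le_of_le_one hδ haa h₄)
  rw [abs_le] at haa h₄ ⊢
  rw [diagTerm]
  constructor <;> linarith

end Bounds

end Expansion

/-! ### The degree-two block: operator norms -/

section Kernels

open Matrix
open scoped Matrix.Norms.L2Operator Kronecker

variable {ι : Type*}

/-- A symmetric matrix with entries of size at most `δ ≤ 1` and rows of squared length at most `r`:
what the norm bounds below use about the off-diagonal part of a correlation matrix. -/
structure EntryBound [Fintype ι] (Y : Matrix ι ι ℝ) (δ r : ℝ) : Prop where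
  apply_comm : ∀ i j, Y i j = Y j i
  nonneg : 0 ≤ δ
  le_one : δ ≤ 1
  abs_apply_le : ∀ i j, |Y i j| ≤ δ
  row_nonneg : 0 ≤ r
  row_sq_le : ∀ i, ∑ j, Y i j ^ 2 ≤ r

/-- `highTerm` as a matrix indexed by ordered pairs. -/
noncomputable def highKernel (Y : Matrix ι ι ℝ) : Matrix (ι × ι) (ι × ι) ℝ :=
  .of fun p q => highTerm (Y p.1 p.2) (Y p.1 q.1) (Y p.1 q.2) (Y p.2 q.1) (Y p.2 q.2) (Y q.1 q.2)

/-- `commonTerm` as a matrix indexed by ordered pairs, supported on the pairs of pairs that share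
their first index. -/
noncomputable def commonKernel [DecidableEq ι] (Y : Matrix ι ι ℝ) : Matrix (ι × ι) (ι × ι) ℝ :=
  .of fun p q => if p.1 = q.1 then commonTerm (Y p.1 p.2) (Y p.1 q.2) (Y p.2 q.2) else 0

/-- The sum of a matrix indexed by ordered pairs over the exchanges of the indices within the row
pair and within the column pair. -/
def symmetrize (K : Matrix (ι × ι) (ι × ι) ℝ) : Matrix (ι × ι) (ι × ι) ℝ :=
  K + K.submatrix Prod.swap id + K.submatrix id Prod.swap + K.submatrix Prod.swap Prod.swap

variable [Fintype ι] [DecidableEq ι]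

lemma norm_symmetrize_le (K : Matrix (ι × ι) (ι × ι) ℝ) : ‖symmetrize K‖ ≤ 4 * ‖K‖ := by
  have h {f g : ι × ι → ι × ι} (hf : f.Injective) (hg : g.Injective) :=
    l2_opNorm_submatrix_le K hf hg
  have hswap : (Prod.swap : ι × ι → ι × ι).Injective := Prod.swap_injective
  have hid : (id : ι × ι → ι × ι).Injective := Function.injective_id
  calc ‖symmetrize K‖ ≤ ‖K‖ + ‖K.submatrix Prod.swap id‖ + ‖K.submatrix id Prod.swap‖
        + ‖K.submatrix Prod.swap Prod.swap‖ := norm_add₄_le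
    _ ≤ ‖K‖ + ‖K‖ + ‖K‖ + ‖K‖ := by gcongr <;> exact h ‹_› ‹_›
    _ = 4 * ‖K‖ := by ring

namespace EntryBound

variable {Y : Matrix ι ι ℝ} {δ r : ℝ}

omit [DecidableEq ι] in
lemma sum_mul_sq_le (h : EntryBound Y δ r) (i j : ι) :
    ∑ p : ι × ι, (Y i p.1 * Y j p.2) ^ 2 ≤ r * r := by
  simp only [mul_pow, Fintype.sum_prod_type]
  rw [← Finset.sum_mul_sum]
  exact mul_le_mul (h.row_sq_le i) (h.row_sq_le j) (by positivity) h.row_nonneg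

lemma norm_map_pow_three_le (h : EntryBound Y δ r) : ‖Y.map (· ^ 3)‖ ≤ δ * r := by
  refine l2_opNorm_le_of_abs_le_mul (f := Y) (g := Y) h.nonneg h.row_nonneg (fun i j => ?_)
    h.row_sq_le fun j => by simpa only [h.apply_comm j] using h.row_sq_le j
  rw [map_apply, abs_pow, pow_succ', sq]
  exact mul_le_mul_of_nonneg_right (h.abs_apply_le i j) (by positivity)

lemma norm_cube_kronecker_le (h : EntryBound Y δ r) : ‖Y.map (· ^ 3) ⊗ₖ Y‖ ≤ δ * r * ‖Y‖ := by
  have hmul : Y.map (· ^ 3) ⊗ₖ Y =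
      ((1 : Matrix ι ι ℝ) ⊗ₖ Y.map (· ^ 3)).submatrix Prod.swap Prod.swap * (1 ⊗ₖ Y) := by
    have hswap : ((1 : Matrix ι ι ℝ) ⊗ₖ Y.map (· ^ 3)).submatrix Prod.swap Prod.swap =
        Y.map (· ^ 3) ⊗ₖ 1 := by
      ext p q
      simp [one_apply, mul_comm]
    rw [hswap, ← mul_kronecker_mul, Matrix.mul_one, Matrix.one_mul]
  rw [hmul]
  refine (l2_opNorm_mul _ _).trans (mul_le_mul ?_ (l2_opNorm_one_kronecker_le Y) (norm_nonneg _)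
    (mul_nonneg h.nonneg h.row_nonneg))
  exact (l2_opNorm_submatrix_le _ Prod.swap_injective Prod.swap_injective).trans <|
    (l2_opNorm_one_kronecker_le _).trans h.norm_map_pow_three_le

lemma norm_sq_mul_mul_le (h : EntryBound Y δ r) :
    ‖(Matrix.of fun p q => Y p.1 q.1 ^ 2 * Y p.1 q.2 * Y p.2 q.1 :
      Matrix (ι × ι) (ι × ι) ℝ)‖ ≤ δ * ‖Y‖ ^ 2 := by
  have hmul : (Matrix.of fun p q => Y p.1 q.1 ^ 2 * Y p.1 q.2 * Y p.2 q.1 :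
      Matrix (ι × ι) (ι × ι) ℝ) = (1 ⊗ₖ Y) * diagonal (fun p => Y p.1 p.2 ^ 2) *
        ((1 : Matrix ι ι ℝ) ⊗ₖ Y).submatrix Prod.swap id := by
    ext p q
    simp [mul_apply, Fintype.sum_prod_type, one_apply, diagonal_apply]
    ring
  have hdiag : ‖(diagonal fun p : ι × ι => Y p.1 p.2 ^ 2 : Matrix (ι × ι) (ι × ι) ℝ)‖ ≤ δ := by
    rw [l2_opNorm_diagonal]
    refine (pi_norm_le_iff_of_nonneg h.nonneg).2 fun p => ?_
    rw [Real.norm_eq_abs, sq]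
    exact abs_mul_le_of_le_one h.le_one (h.abs_apply_le _ _) (h.abs_apply_le _ _)
  have hswap := (l2_opNorm_submatrix_le ((1 : Matrix ι ι ℝ) ⊗ₖ Y) Prod.swap_injective
    Function.injective_id).trans (l2_opNorm_one_kronecker_le Y)
  rw [hmul]
  calc _ ≤ ‖(1 : Matrix ι ι ℝ) ⊗ₖ Y‖ *
        ‖(diagonal fun p : ι × ι => Y p.1 p.2 ^ 2 : Matrix (ι × ι) (ι × ι) ℝ)‖ *
        ‖((1 : Matrix ι ι ℝ) ⊗ₖ Y).submatrix Prod.swap id‖ :=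
      norm_mul₃_le
    _ ≤ ‖Y‖ * δ * ‖Y‖ := by
        gcongr
        · exact mul_nonneg (norm_nonneg _) h.nonneg
        · exact l2_opNorm_one_kronecker_le Y
    _ = δ * ‖Y‖ ^ 2 := by ring

lemma norm_le_of_abs_le_mul_row (h : EntryBound Y δ r) {A : Matrix (ι × ι) (ι × ι) ℝ} {c : ℝ}
    (hc : 0 ≤ c) (f₁ f₂ g₁ g₂ : ι × ι → ι)
    (hA : ∀ p q, |A p q| ≤
      c * δ * (|Y (f₁ p) q.1 * Y (f₂ p) q.2| * |Y (g₁ q) p.1 * Y (g₂ q) p.2|)) :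
    ‖A‖ ≤ c * δ * (r * r) :=
  l2_opNorm_le_of_abs_le_mul (f := .of fun p q => Y (f₁ p) q.1 * Y (f₂ p) q.2)
    (g := .of fun p q => Y (g₁ q) p.1 * Y (g₂ q) p.2) (mul_nonneg hc h.nonneg)
    (mul_self_nonneg r) hA (fun _ => h.sum_mul_sq_le _ _) fun _ => h.sum_mul_sq_le _ _

omit [DecidableEq ι] in
lemma abs_mul_apply_le (h : EntryBound Y δ r) (i j k l : ι) : |Y i j * Y k l| ≤ δ :=
  abs_mul_le_of_le_one h.le_one (h.abs_apply_le i j) (h.abs_apply_le k l)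

lemma norm_apply_mul_le (h : EntryBound Y δ r) :
    ‖(Matrix.of fun p q => Y q.1 q.2 * Y p.1 q.2 ^ 2 * Y p.1 q.1 * Y p.2 q.1 :
      Matrix (ι × ι) (ι × ι) ℝ)‖ ≤ 1 * δ * (r * r) := by
  refine h.norm_le_of_abs_le_mul_row zero_le_one Prod.fst Prod.fst Prod.snd Prod.fst
    fun p q => ?_
  rw [← abs_mul, h.apply_comm q.2 p.1, h.apply_comm q.1 p.2]
  calc _ = |Y q.1 q.2| * |Y p.1 q.1 * Y p.1 q.2 * (Y p.1 q.2 * Y p.2 q.1)| := by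
        rw [of_apply, ← abs_mul]; ring_nf
    _ ≤ _ := mul_le_mul_of_nonneg_right ((h.abs_apply_le _ _).trans_eq (one_mul δ).symm)
        (abs_nonneg _)

lemma norm_apply_mul_transpose_le (h : EntryBound Y δ r) :
    ‖(Matrix.of fun p q => Y p.1 p.2 * Y p.2 q.1 ^ 2 * Y p.1 q.1 * Y p.1 q.2 :
      Matrix (ι × ι) (ι × ι) ℝ)‖ ≤ 1 * δ * (r * r) := by
  refine (l2_opNorm_conjTranspose _).symm.trans_le (Eq.trans_le ?_ h.norm_apply_mul_le)
  congr 1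
  ext p q
  simp [h.apply_comm q.2 p.1, h.apply_comm q.1 p.1, h.apply_comm q.1 p.2]

lemma norm_mul_sq_le (h : EntryBound Y δ r) :
    ‖(Matrix.of fun p q => (2 * (Y p.1 p.2 * Y q.1 q.2) + 2 / 9 * (Y p.1 q.1 * Y p.2 q.2) +
      2 * (Y p.1 q.2 * Y p.2 q.1)) * (Y p.1 q.1 * Y p.2 q.2) ^ 2 :
      Matrix (ι × ι) (ι × ι) ℝ)‖ ≤ 38 / 9 * δ * (r * r) := by
  refine h.norm_le_of_abs_le_mul_row (by norm_num) Prod.fst Prod.snd Prod.fst Prod.snd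
    fun p q => ?_
  rw [h.apply_comm q.1, h.apply_comm q.2, abs_mul_abs_self, of_apply, abs_mul, abs_sq, ← sq]
  refine mul_le_mul_of_nonneg_right (abs_le.2 ?_) (sq_nonneg _)
  have h₁ := abs_le.1 (h.abs_mul_apply_le p.1 p.2 q.1 q.2)
  have h₂ := abs_le.1 (h.abs_mul_apply_le p.1 q.1 p.2 q.2)
  have h₃ := abs_le.1 (h.abs_mul_apply_le p.1 q.2 p.2 q.1)
  constructor <;> linarith

lemma norm_mul_mul_le (h : EntryBound Y δ r) :
    ‖(Matrix.of fun p q =>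
      Y p.1 p.2 * Y q.1 q.2 * Y p.1 q.1 * Y p.2 q.2 * Y p.1 q.2 * Y p.2 q.1 :
      Matrix (ι × ι) (ι × ι) ℝ)‖ ≤ 1 * δ * (r * r) := by
  refine h.norm_le_of_abs_le_mul_row zero_le_one Prod.fst Prod.snd Prod.snd Prod.fst
    fun p q => ?_
  rw [← abs_mul, h.apply_comm q.2 p.1, h.apply_comm q.1 p.2]
  calc _ = |Y p.1 p.2 * Y q.1 q.2| * |Y p.1 q.1 * Y p.2 q.2 * (Y p.1 q.2 * Y p.2 q.1)| := by
        rw [of_apply, ← abs_mul]; ring_nf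
    _ ≤ _ := mul_le_mul_of_nonneg_right ((h.abs_mul_apply_le _ _ _ _).trans_eq (one_mul δ).symm)
        (abs_nonneg _)

lemma norm_highKernel_le (h : EntryBound Y δ r) :
    ‖highKernel Y‖ ≤ δ * (2 / 3 * (r * ‖Y‖) + 2 * ‖Y‖ ^ 2 + 17 * (r * r)) := by
  have hsmul {c b : ℝ} {K : Matrix (ι × ι) (ι × ι) ℝ} (hc : 0 ≤ c) (hK : ‖K‖ ≤ b) :
      ‖c • K‖ ≤ c * b := by
    rw [norm_smul_of_nonneg hc]
    exact mul_le_mul_of_nonneg_left hK hc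
  have hsum : highKernel Y = (2 / 3 : ℝ) • (Y.map (· ^ 3) ⊗ₖ Y)
      + (2 : ℝ) • (of fun p q => Y p.1 q.1 ^ 2 * Y p.1 q.2 * Y p.2 q.1)
      - (4 : ℝ) • ((of fun p q => Y q.1 q.2 * Y p.1 q.2 ^ 2 * Y p.1 q.1 * Y p.2 q.1)
        + of fun p q => Y p.1 p.2 * Y p.2 q.1 ^ 2 * Y p.1 q.1 * Y p.1 q.2)
      + (of fun p q => (2 * (Y p.1 p.2 * Y q.1 q.2) + 2 / 9 * (Y p.1 q.1 * Y p.2 q.2) +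
        2 * (Y p.1 q.2 * Y p.2 q.1)) * (Y p.1 q.1 * Y p.2 q.2) ^ 2)
      + (4 : ℝ) • (of fun p q =>
        Y p.1 p.2 * Y q.1 q.2 * Y p.1 q.1 * Y p.2 q.2 * Y p.1 q.2 * Y p.2 q.1) := by
    ext p q
    simp [highKernel, highTerm]
    ring
  rw [hsum]
  refine (norm_add_le_of_le (norm_add_le_of_le (norm_sub_le_of_le (norm_add_le_of_le
    (hsmul (by norm_num) h.norm_cube_kronecker_le) (hsmul zero_le_two h.norm_sq_mul_mul_le))
    (hsmul zero_le_four (norm_add_le_of_le h.norm_apply_mul_le h.norm_apply_mul_transpose_le)))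
    h.norm_mul_sq_le) (hsmul zero_le_four h.norm_mul_mul_le)).trans ?_
  linarith [mul_nonneg h.nonneg (mul_self_nonneg r)]

lemma norm_commonKernel_le (h : EntryBound Y δ r) : ‖commonKernel Y‖ ≤ 86 / 3 * δ * r := by
  let K : Matrix (ι × ι) (ι × ι) ℝ := .of fun p q =>
    if p.1 = q.1 then Y p.1 q.2 * Y p.1 p.2 * commonFactor (Y p.1 p.2) (Y p.1 q.2) (Y p.2 q.2)
    else 0
  have hK : ‖K‖ ≤ 28 * δ * r := by
    refine l2_opNorm_le_of_abs_le_mul (f := .of fun p q => if p.1 = q.1 then Y p.1 q.2 else 0)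
      (g := .of fun p q => if p.1 = q.1 then Y q.1 p.2 else 0)
      (mul_nonneg (by norm_num) h.nonneg) h.row_nonneg (fun p q => ?_) (fun p => ?_) fun q => ?_
    · by_cases hpq : p.1 = q.1
      · simp only [K, of_apply, hpq, if_true]
        rw [abs_mul, abs_mul, mul_comm]
        exact mul_le_mul_of_nonneg_right (abs_commonFactor_le h.le_one (h.abs_apply_le _ _)
          (h.abs_apply_le _ _) (h.abs_apply_le _ _)) (by positivity)
      · simp [K, hpq]
    · simpa [ite_pow, Fintype.sum_prod_type] using h.row_sq_le p.1
    · simpa [ite_pow, Fintype.sum_prod_type] using h.row_sq_le q.1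
  have hsum : commonKernel Y = (2 / 3 : ℝ) • ((1 : Matrix ι ι ℝ) ⊗ₖ Y.map (· ^ 3)) - K := by
    ext p q
    by_cases hpq : p.1 = q.1
    · simp [commonKernel, commonTerm, K, one_apply, hpq, mul_comm (Y q.1 p.2)]
    · simp [commonKernel, K, hpq]
  rw [hsum]
  refine (norm_sub_le_of_le (norm_smul_of_nonneg (by norm_num) _).le hK).trans ?_
  linarith [(l2_opNorm_one_kronecker_le (ι := ι) _).trans h.norm_map_pow_three_le]

end EntryBound

end Kernels

/-! ### The degree-two block: decomposition -/

section PairBlock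

open Matrix
open scoped Matrix.Norms.L2Operator Kronecker

section

variable {ι : Type*} [Fintype ι] [DecidableEq ι]

/-- The part of the degree-two block of the moment matrix of `1 + Y` that `lowPart` misses, as a
matrix indexed by ordered pairs. -/
noncomputable def pairError (Y : Matrix ι ι ℝ) : Matrix (ι × ι) (ι × ι) ℝ :=
  symmetrize (highKernel Y + commonKernel Y) + diagonal fun p => diagTerm (Y p.1 p.2)

lemma EntryBound.norm_pairError_le {Y : Matrix ι ι ℝ} {δ r s : ℝ} (h : EntryBound Y δ r)
    (hs : ‖Y‖ ≤ 1 + s) : ‖pairError Y‖ ≤ 200 * δ * (1 + r ^ 2) * (1 + s ^ 2) := by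
  have hdiag : ‖(diagonal fun p => diagTerm (Y p.1 p.2) : Matrix (ι × ι) (ι × ι) ℝ)‖
      ≤ 18 * δ := by
    rw [l2_opNorm_diagonal]
    exact (pi_norm_le_iff_of_nonneg (mul_nonneg (by norm_num) h.nonneg)).2 fun p =>
      abs_diagTerm_le h.le_one (h.abs_apply_le _ _)
  have hnorm : ‖pairError Y‖ ≤
      δ * (4 * (2 / 3 * (r * ‖Y‖) + 2 * ‖Y‖ ^ 2 + 17 * (r * r) + 86 / 3 * r) + 18) := by
    refine (norm_add_le_of_le ((norm_symmetrize_le _).trans (mul_le_mul_of_nonneg_left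
      (norm_add_le_of_le h.norm_highKernel_le h.norm_commonKernel_le) zero_le_four)) hdiag).trans ?_
    exact le_of_eq (by ring)
  have hsq : ‖Y‖ ^ 2 ≤ 2 * (1 + s ^ 2) := by
    nlinarith [pow_le_pow_left₀ (norm_nonneg Y) hs 2, sq_nonneg (1 - s)]
  have hrow : r ≤ (1 + r ^ 2) / 2 := by linarith [sq_nonneg (1 - r)]
  have hmix : r * ‖Y‖ ≤ (r ^ 2 + ‖Y‖ ^ 2) / 2 := by linarith [sq_nonneg (r - ‖Y‖)]
  calc ‖pairError Y‖ ≤ δ * (200 * ((1 + r ^ 2) * (1 + s ^ 2))) := by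
        refine hnorm.trans (mul_le_mul_of_nonneg_left ?_ h.nonneg)
        nlinarith [mul_nonneg (sq_nonneg r) (sq_nonneg s), sq_nonneg r, sq_nonneg s]
    _ = 200 * δ * (1 + r ^ 2) * (1 + s ^ 2) := by ring

/-- The vector whose Gram matrix for the form `X ⊗ₖ X` gives the terms of Wick degree two. -/
def pairVec (X : Matrix ι ι ℝ) (p : ι × ι) : ι × ι → ℝ :=
  (1 + 2 * X p.1 p.2 ^ 2) • (Pi.single (p.1, p.2) 1 + Pi.single (p.2, p.1) 1) -
    (2 * X p.1 p.2) • (Pi.single (p.1, p.1) 1 + Pi.single (p.2, p.2) 1)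

/-- The terms of Wick degree two as a matrix indexed by ordered pairs. -/
noncomputable def gramKernel (X : Matrix ι ι ℝ) : Matrix (ι × ι) (ι × ι) ℝ :=
  (1 / 2 : ℝ) • (of (pairVec X) * (X ⊗ₖ X) * (of (pairVec X))ᴴ)

lemma posSemidef_gramKernel {X : Matrix ι ι ℝ} (hX : X.PosSemidef) : (gramKernel X).PosSemidef :=
  ((hX.kronecker hX).mul_mul_conjTranspose_same _).smul (by norm_num)

lemma lowPart_eq (X : Matrix ι ι ℝ) (p q : ι × ι) :
    lowPart (X p.1 p.2) (X p.1 q.1) (X p.1 q.2) (X p.2 q.1) (X p.2 q.2) (X q.1 q.2) =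
      pairMoment (X p.1 p.2) * pairMoment (X q.1 q.2) + gramKernel X p q := by
  have hentry : gramKernel X p q = 1 / 2 * (pairVec X p ⬝ᵥ (X ⊗ₖ X) *ᵥ pairVec X q) := by
    rw [gramKernel, Matrix.mul_assoc]
    rfl
  rw [hentry]
  simp [pairVec, lowPart, add_dotProduct, sub_dotProduct, dotProduct_add, mulVec_add, mulVec_sub,
    mulVec_smul]
  ring

/-- The entry of the moment matrix at two distinct pairs, as a function of ordered pairs. -/
noncomputable def distinctPairMoment (X : Matrix ι ι ℝ) (p q : ι × ι) : ℝ :=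
  pairMoment (X p.1 p.2) * pairMoment (X q.1 q.2) + gramKernel X p q +
    symmetrize (highKernel (X - 1) + commonKernel (X - 1)) p q

lemma distinctPairMoment_swap_left {X : Matrix ι ι ℝ} (hX : X.IsHermitian) (p q : ι × ι) :
    distinctPairMoment X p.swap q = distinctPairMoment X p q := by
  rw [distinctPairMoment, distinctPairMoment, ← lowPart_eq, ← lowPart_eq]
  simp only [symmetrize, lowPart, Matrix.add_apply, submatrix_apply, Prod.fst_swap, Prod.snd_swap,
    Prod.swap_swap, id_eq, show X p.2 p.1 = X p.1 p.2 from hX.apply _ _]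
  ring

lemma distinctPairMoment_swap_right {X : Matrix ι ι ℝ} (hX : X.IsHermitian) (p q : ι × ι) :
    distinctPairMoment X p q.swap = distinctPairMoment X p q := by
  rw [distinctPairMoment, distinctPairMoment, ← lowPart_eq, ← lowPart_eq]
  simp only [symmetrize, lowPart, Matrix.add_apply, submatrix_apply, Prod.fst_swap, Prod.snd_swap,
    Prod.swap_swap, id_eq, show X q.2 q.1 = X q.1 q.2 from hX.apply _ _]
  ring

end

section

variable {n : ℕ} {X : Matrix (Fin n) (Fin n) ℝ}

/-- The unordered pair `{i, j}` as an index. -/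
def pairIdx (i j : Fin n) : Idx n := ⟨{i, j}, Finset.card_le_two⟩

lemma pairIdx_comm (i j : Fin n) : pairIdx i j = pairIdx j i := Subtype.ext (Finset.pair_comm i j)

lemma momentMatrix_pairIdx_of_common (hX : X ∈ SoS2 n) {i j l : Fin n} (hij : i ≠ j) (hil : i ≠ l)
    (hjl : j ≠ l) :
    momentMatrix X (pairIdx i j) (pairIdx i l) = distinctPairMoment X (i, j) (i, l) := by
  have hcomm : ∀ a b, X a b = X b a := fun a b => hX.1.1.apply b a
  rw [distinctPairMoment, ← lowPart_eq,
    momentMatrix_pair hX hjl (by grind [pairIdx, Finset.mem_symmDiff]),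
    pairMoment_eq (X i j) (X i l) (X j l)]
  simp [symmetrize, highKernel, commonKernel, lowPart, hX.2, hij, hij.symm, hil, hil.symm, hjl,
    hcomm]
  ring

lemma momentMatrix_pairIdx_of_disjoint (hX : X ∈ SoS2 n) {i j k l : Fin n} (hij : i ≠ j)
    (hik : i ≠ k) (hil : i ≠ l) (hjk : j ≠ k) (hjl : j ≠ l) (hkl : k ≠ l) :
    momentMatrix X (pairIdx i j) (pairIdx k l) = distinctPairMoment X (i, j) (k, l) := by
  have hcomm : ∀ a b, X a b = X b a := fun a b => hX.1.1.apply b a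
  rw [distinctPairMoment, ← lowPart_eq, momentMatrix_quart hX hij hik hil hjk hjl hkl
    (by grind [pairIdx, Finset.mem_symmDiff]), quartMoment_eq]
  simp [symmetrize, highKernel, commonKernel, hij, hij.symm, hkl, hkl.symm, hik, hil, hjk, hjl,
    hcomm j i, hcomm l k]

lemma momentMatrix_pairIdx_of_ne (hX : X ∈ SoS2 n) {p q : Fin n × Fin n} (hp : p.1 < p.2)
    (hq : q.1 < q.2) (hpq : p ≠ q) :
    momentMatrix X (pairIdx p.1 p.2) (pairIdx q.1 q.2) = distinctPairMoment X p q := by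
  obtain ⟨⟨i, j⟩, k, l⟩ := p, q
  have hij : i ≠ j := hp.ne
  have hkl : k ≠ l := hq.ne
  rcases eq_or_ne i k with rfl | hik
  · exact momentMatrix_pairIdx_of_common hX hij hkl fun h => hpq (Prod.ext rfl h)
  rcases eq_or_ne i l with rfl | hil
  · rw [← distinctPairMoment_swap_right hX.1.1, pairIdx_comm k]
    exact momentMatrix_pairIdx_of_common hX hij hkl.symm (hq.trans hp).ne'
  rcases eq_or_ne j k with rfl | hjk
  · rw [← distinctPairMoment_swap_left hX.1.1, pairIdx_comm i]
    exact momentMatrix_pairIdx_of_common hX hij.symm hkl hil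
  rcases eq_or_ne j l with rfl | hjl
  · rw [← distinctPairMoment_swap_left hX.1.1, ← distinctPairMoment_swap_right hX.1.1,
      pairIdx_comm i, pairIdx_comm k]
    exact momentMatrix_pairIdx_of_common hX hij.symm hkl.symm hik
  exact momentMatrix_pairIdx_of_disjoint hX hij hik hil hjk hjl hkl

lemma momentMatrix_pairIdx (hX : X ∈ SoS2 n) {p q : Fin n × Fin n} (hp : p.1 < p.2)
    (hq : q.1 < q.2) : momentMatrix X (pairIdx p.1 p.2) (pairIdx q.1 q.2) =
      pairMoment (X p.1 p.2) * pairMoment (X q.1 q.2) + gramKernel X p q +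
        pairError (X - 1) p q := by
  rcases eq_or_ne p q with rfl | hpq
  · obtain ⟨i, j⟩ := p
    have hij : i ≠ j := hp.ne
    have hcomm : X j i = X i j := hX.1.1.apply _ _
    rw [momentMatrix_self hX, ← lowPart_eq, one_eq_lowPart_add (X i j)]
    simp [pairError, symmetrize, highKernel, commonKernel, hX.2, hij, hij.symm, hcomm]
    ring
  · rw [momentMatrix_pairIdx_of_ne hX hp hq hpq, distinctPairMoment, pairError, Matrix.add_apply,
      diagonal_apply_ne _ hpq, add_zero]

end

end PairBlock

/-! ### Feasibility of the lift -/

section Feasibility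

open Matrix
open scoped Matrix.Norms.L2Operator

variable {n : ℕ} {X : Matrix (Fin n) (Fin n) ℝ}

lemma alphaMag_nonneg (X : Matrix (Fin n) (Fin n) ℝ) : 0 ≤ alphaMag X :=
  Real.iSup_nonneg fun _ => abs_nonneg _

lemma alphaRow_nonneg (X : Matrix (Fin n) (Fin n) ℝ) : 0 ≤ alphaRow X :=
  Real.iSup_nonneg fun _ => Real.sqrt_nonneg _

lemma alpha_nonneg {C : ℝ} (hC : 0 ≤ C) (X : Matrix (Fin n) (Fin n) ℝ) : 0 ≤ alpha C X := by
  have := alphaMag_nonneg X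
  unfold alpha
  positivity

lemma abs_apply_le_alphaMag (X : Matrix (Fin n) (Fin n) ℝ) {i j : Fin n} (h : i ≠ j) :
    |X i j| ≤ alphaMag X :=
  le_ciSup (f := fun p : {p : Fin n × Fin n // p.1 ≠ p.2} => |X p.1.1 p.1.2|)
    (Set.finite_range _).bddAbove ⟨(i, j), h⟩

lemma sum_sq_le_alphaRow (X : Matrix (Fin n) (Fin n) ℝ) (i : Fin n) :
    ∑ j ∈ Finset.univ.erase i, X i j ^ 2 ≤ alphaRow X ^ 2 := by
  rw [← Real.sqrt_le_left (alphaRow_nonneg X)]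
  exact le_ciSup (f := fun i : Fin n => √(∑ j ∈ Finset.univ.erase i, X i j ^ 2))
    (Set.finite_range _).bddAbove i

lemma abs_apply_le_one (hX : X ∈ SoS2 n) (i j : Fin n) : |X i j| ≤ 1 := by
  obtain ⟨M, hM⟩ := exists_mul_transpose_eq hX.1
  have hdot : ∀ i k, ∑ p, M i p * M k p = X i k := fun i k => by
    rw [← hM, mul_apply]
    rfl
  have h := Finset.sum_mul_sq_le_sq_mul_sq Finset.univ (M i) (M j)
  simp only [sq (M _ _)] at h
  rw [hdot, hdot, hdot, hX.2, hX.2, mul_one] at h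
  exact (sq_le_one_iff_abs_le_one _).1 h

lemma entryBound_sub_one (hX : X ∈ SoS2 n) :
    EntryBound (X - 1) (alphaMag X) (alphaRow X ^ 2) where
  apply_comm := fun i j => (hX.1.1.sub isHermitian_one).apply j i
  nonneg := alphaMag_nonneg X
  le_one := Real.iSup_le (fun _ => abs_apply_le_one hX _ _) zero_le_one
  abs_apply_le i j := by
    rcases eq_or_ne i j with rfl | hij
    · simpa [hX.2] using alphaMag_nonneg X
    · simpa [hij] using abs_apply_le_alphaMag X hij
  row_nonneg := sq_nonneg _
  row_sq_le i := by
    refine le_of_eq_of_le ?_ (sum_sq_le_alphaRow X i)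
    rw [← Finset.add_sum_erase _ _ (Finset.mem_univ i), Matrix.sub_apply, hX.2, one_apply_eq,
      sub_self, sq, zero_mul, zero_add]
    refine Finset.sum_congr rfl fun j hj => ?_
    rw [Matrix.sub_apply, one_apply_ne (Finset.ne_of_mem_erase hj).symm, sub_zero]

lemma norm_sub_one_le (X : Matrix (Fin n) (Fin n) ℝ) : ‖X - 1‖ ≤ 1 + alphaSpec X := by
  have hone : ‖(1 : Matrix (Fin n) (Fin n) ℝ)‖ ≤ 1 := by
    rw [← diagonal_one, l2_opNorm_diagonal]
    exact (pi_norm_le_iff_of_nonneg zero_le_one).2 fun _ => norm_one.le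
  exact (norm_sub_le_of_le le_rfl hone).trans_eq (add_comm _ _)

lemma norm_pairError_sub_one_le (hX : X ∈ SoS2 n) : ‖pairError (X - 1)‖ ≤ alpha 200 X := by
  refine ((entryBound_sub_one hX).norm_pairError_le (norm_sub_one_le X)).trans_eq ?_
  rw [alpha, ← pow_mul]

lemma norm_cube_sub_one_le (hX : X ∈ SoS2 n) :
    ‖(2 / 3 : ℝ) • (X - 1).map (· ^ 3)‖ ≤ alpha 200 X := by
  rw [norm_smul_of_nonneg (by norm_num)]
  have hrow : alphaRow X ^ 2 ≤ 1 + alphaRow X ^ 4 := by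
    nlinarith [sq_nonneg (alphaRow X ^ 2 - 1), sq_nonneg (alphaRow X ^ 2)]
  calc 2 / 3 * ‖(X - 1).map (· ^ 3)‖ ≤ 2 / 3 * (alphaMag X * alphaRow X ^ 2) := by
        gcongr
        exact (entryBound_sub_one hX).norm_map_pow_three_le
    _ ≤ 200 * (alphaMag X * (1 + alphaRow X ^ 4)) * 1 := by
        nlinarith [mul_le_mul_of_nonneg_left hrow (alphaMag_nonneg X),
          mul_nonneg (alphaMag_nonneg X) (sq_nonneg (alphaRow X))]
    _ ≤ 200 * (alphaMag X * (1 + alphaRow X ^ 4)) * (1 + alphaSpec X ^ 2) := by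
        have := alphaMag_nonneg X
        gcongr
        exact le_add_of_nonneg_right (sq_nonneg _)
    _ = alpha 200 X := by rw [alpha]; ring

/-- The pairs with increasing entries, one for each two-element subset. -/
abbrev IncPair (n : ℕ) : Type := {p : Fin n × Fin n // p.1 < p.2}

/-- The index sets of size at most two sorted by size: singletons, the empty set, pairs. -/
def idxOfSum : Fin n ⊕ Unit ⊕ IncPair n → Idx n :=
  Sum.elim single (Sum.elim (fun _ => emptyIdx n) fun p => pairIdx p.1.1 p.1.2)

lemma single_injective : Function.Injective (single (n := n)) := fun _ _ h =>
  Finset.singleton_injective (congrArg Subtype.val h)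

lemma card_pairIdx {i j : Fin n} (hij : i ≠ j) : (pairIdx i j).1.card = 2 :=
  Finset.card_pair hij

lemma pairIdx_injective :
    Function.Injective fun p : IncPair n => pairIdx p.1.1 p.1.2 := by
  rintro ⟨⟨i, j⟩, hij : i < j⟩ ⟨⟨k, l⟩, hkl : k < l⟩ h
  have hset : ({i, j} : Set (Fin n)) = {k, l} := by
    simpa [pairIdx] using! congrArg (fun S : Idx n => (S.1 : Set (Fin n))) h
  obtain ⟨rfl, rfl⟩ | ⟨rfl, rfl⟩ := Set.pair_eq_pair_iff.1 hset
  · rfl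
  · exact absurd hij hkl.asymm

lemma idxOfSum_bijective : Function.Bijective (idxOfSum (n := n)) := by
  constructor
  · refine single_injective.sumElim ((Function.injective_of_subsingleton _).sumElim
      pairIdx_injective fun _ p h => ?_) ?_
    · simpa [card_pairIdx p.2.ne, emptyIdx] using congrArg (fun S : Idx n => S.1.card) h
    · rintro i (_ | p) h
      · simpa [single, emptyIdx] using congrArg (fun S : Idx n => S.1.card) h
      · simpa [card_pairIdx p.2.ne, single] using congrArg (fun S : Idx n => S.1.card) h
  · rintro ⟨S, hS⟩
    obtain h | h | h : S.card = 0 ∨ S.card = 1 ∨ S.card = 2 := by omega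
    · exact ⟨.inr (.inl ()), Subtype.ext (Finset.card_eq_zero.1 h).symm⟩
    · obtain ⟨i, rfl⟩ := Finset.card_eq_one.1 h
      exact ⟨.inl i, rfl⟩
    · obtain ⟨i, j, hij, rfl⟩ := Finset.card_eq_two.1 h
      rcases hij.lt_or_gt with hij | hji
      · exact ⟨.inr (.inr ⟨(i, j), hij⟩), rfl⟩
      · exact ⟨.inr (.inr ⟨(j, i), hji⟩), pairIdx_comm j i⟩

lemma odd_card_symmDiff_pair (i : Fin n) {j k : Fin n} (hjk : j ≠ k) :
    Odd ((single i).1 ∆ (pairIdx j k).1).card := by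
  by_cases hi : i ∈ (pairIdx j k).1
  · have hsub : (single i).1 ⊆ (pairIdx j k).1 := Finset.singleton_subset_iff.2 hi
    rw [symmDiff_of_le hsub, Finset.card_sdiff_of_subset hsub, card_pairIdx hjk, single,
      Finset.card_singleton]
    decide
  · have hdisj : Disjoint (single i).1 (pairIdx j k).1 := Finset.disjoint_singleton_left.2 hi
    rw [hdisj.symmDiff_eq_sup, Finset.sup_eq_union, Finset.card_union_of_disjoint hdisj,
      card_pairIdx hjk, single, Finset.card_singleton]
    decide

lemma momentMatrix_comm (X : Matrix (Fin n) (Fin n) ℝ) (S T : Idx n) :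
    momentMatrix X S T = momentMatrix X T S := by
  rw [momentMatrix, of_apply, of_apply, symmDiff_comm]

/-- The block of the moment matrix indexed by singletons. -/
noncomputable def singleBlock (X : Matrix (Fin n) (Fin n) ℝ) : Matrix (Fin n) (Fin n) ℝ :=
  X + (2 / 3 : ℝ) • (X - 1).map (· ^ 3)

lemma single_symmDiff_single {i j : Fin n} (hij : i ≠ j) :
    (single i).1 ∆ (single j).1 = {i, j} :=
  (Finset.disjoint_singleton.2 hij).symmDiff_eq_sup

lemma momentMatrix_single (hX : X ∈ SoS2 n) (i j : Fin n) :
    momentMatrix X (single i) (single j) = singleBlock X i j := by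
  rcases eq_or_ne i j with rfl | hij
  · simp [momentMatrix_self hX, singleBlock, hX.2]
  · rw [momentMatrix_pair hX hij (single_symmDiff_single hij)]
    simp [singleBlock, pairMoment, hij]

lemma posSemidef_singleBlock_add (hX : X ∈ SoS2 n) :
    (singleBlock X + alpha 200 X • (1 : Matrix _ _ ℝ)).PosSemidef := by
  rw [singleBlock, add_assoc]
  refine hX.1.add (posSemidef_add_smul_one ?_ (norm_cube_sub_one_le hX))
  ext i j
  simp [(entryBound_sub_one hX).apply_comm i j]

/-- The block of the moment matrix indexed by pairs, up to the rank-one matrix of the products of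
the pair moments. -/
noncomputable def pairBlock (X : Matrix (Fin n) (Fin n) ℝ) : Matrix (IncPair n) (IncPair n) ℝ :=
  (gramKernel X).submatrix (↑) (↑) + (pairError (X - 1)).submatrix (↑) (↑)

lemma momentMatrix_pairBlock (hX : X ∈ SoS2 n) (p q : IncPair n) :
    momentMatrix X (pairIdx p.1.1 p.1.2) (pairIdx q.1.1 q.1.2) =
      pairMoment (X p.1.1 p.1.2) * pairMoment (X q.1.1 q.1.2) + pairBlock X p q := by
  rw [momentMatrix_pairIdx hX p.2 q.2, add_assoc]
  rfl

lemma posSemidef_pairBlock_add (hX : X ∈ SoS2 n) :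
    (pairBlock X + alpha 200 X • (1 : Matrix _ _ ℝ)).PosSemidef := by
  have hgram := posSemidef_gramKernel hX.1
  rw [pairBlock, add_assoc]
  refine (hgram.submatrix _).add (posSemidef_add_smul_one (.ext fun p q => ?_)
    ((l2_opNorm_submatrix_le _ Subtype.val_injective Subtype.val_injective).trans
      (norm_pairError_sub_one_le hX)))
  have hpq := momentMatrix_pairIdx hX p.2 q.2
  have hqp := momentMatrix_pairIdx hX q.2 p.2
  have hsymm := hgram.1.apply p.1 q.1
  rw [momentMatrix_comm, hpq] at hqp
  simp only [star_trivial, submatrix_apply] at hsymm ⊢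
  linarith

lemma momentMatrix_submatrix_idxOfSum (hX : X ∈ SoS2 n) :
    let u : Fin n ⊕ Unit ⊕ IncPair n → ℝ :=
      Sum.elim 0 (Sum.elim 1 fun p => pairMoment (X p.1.1 p.1.2))
    (momentMatrix X).submatrix idxOfSum idxOfSum =
      vecMulVec u u + fromBlocks (singleBlock X) 0 0 (fromBlocks 0 0 0 (pairBlock X)) := by
  have hempty (i : Fin n) : momentMatrix X (single i) (emptyIdx n) = 0 :=
    momentMatrix_odd hX (by simp [single, emptyIdx, ← Finset.bot_eq_empty])
  have hpair (i : Fin n) (p : IncPair n) :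
      momentMatrix X (single i) (pairIdx p.1.1 p.1.2) = 0 :=
    momentMatrix_odd hX (odd_card_symmDiff_pair i p.2.ne)
  have hemptyPair (p : IncPair n) : momentMatrix X (emptyIdx n) (pairIdx p.1.1 p.1.2) =
      pairMoment (X p.1.1 p.1.2) :=
    momentMatrix_pair hX p.2.ne (by simp [emptyIdx, pairIdx])
  ext (i | _ | p) (j | _ | q) <;>
    simp [idxOfSum, vecMulVec_apply, hempty, hpair, hemptyPair, momentMatrix_self hX,
      momentMatrix_single hX, momentMatrix_pairBlock hX,
      momentMatrix_comm X (emptyIdx n) (single _), momentMatrix_comm X (pairIdx _ _) (single _),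
      momentMatrix_comm X (pairIdx _ _) (emptyIdx n)]

lemma posSemidef_momentMatrix_add (hX : X ∈ SoS2 n) :
    (momentMatrix X + alpha 200 X • (1 : Matrix _ _ ℝ)).PosSemidef := by
  have hα : 0 ≤ alpha 200 X := alpha_nonneg (by norm_num) X
  rw [← posSemidef_submatrix_equiv (.ofBijective _ idxOfSum_bijective), Equiv.coe_ofBijective,
    submatrix_add, Pi.add_apply, Pi.add_apply, submatrix_smul, Pi.smul_apply, Pi.smul_apply,
    submatrix_one _ idxOfSum_bijective.1, momentMatrix_submatrix_idxOfSum hX, add_assoc,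
    ← fromBlocks_one, ← fromBlocks_one, fromBlocks_smul, fromBlocks_smul, fromBlocks_add,
    fromBlocks_add]
  simp only [smul_zero, add_zero, zero_add]
  exact (posSemidef_vecMulVec_self_star _).add
    (posSemidef_fromBlocks_zero (posSemidef_singleBlock_add hX)
      (posSemidef_fromBlocks_zero (PosSemidef.one.smul hα) (posSemidef_pairBlock_add hX)))

lemma lift_eq {C : ℝ} (hC : 0 ≤ C) (X : Matrix (Fin n) (Fin n) ℝ) :
    lift C X = (1 + alpha C X)⁻¹ • (momentMatrix X + alpha C X • 1) := by
  have hα := alpha_nonneg hC X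
  have hη : 1 - alpha C X / (1 + alpha C X) = (1 + alpha C X)⁻¹ := by
    field_simp
    ring
  rw [lift, hη, smul_add, smul_smul, div_eq_inv_mul]

lemma lift_apply {C : ℝ} (hC : 0 ≤ C) (X : Matrix (Fin n) (Fin n) ℝ) (S T : Idx n) :
    lift C X S T = (momentMatrix X S T + if S = T then alpha C X else 0) / (1 + alpha C X) := by
  rw [lift_eq hC, div_eq_inv_mul]
  simp [one_apply]

lemma lift_mem_SoS4 (hX : X ∈ SoS2 n) : lift 200 X ∈ SoS4 n := by
  have hC : (0 : ℝ) ≤ 200 := by norm_num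
  have hα := alpha_nonneg hC X
  refine ⟨fun S T S' T' h => ?_, ?_, ?_⟩
  · have hmoment : momentMatrix X S T = momentMatrix X S' T' := by
      simp only [momentMatrix, of_apply, h]
    have heq : S = T ↔ S' = T' := by
      rw [Subtype.ext_iff, Subtype.ext_iff, ← symmDiff_eq_bot, h, symmDiff_eq_bot]
    simp only [lift_apply hC, hmoment, heq]
  · rw [lift_apply hC, momentMatrix_self hX, if_pos rfl, div_self (by positivity)]
  · rw [lift_eq hC]
    exact (posSemidef_momentMatrix_add hX).smul (inv_nonneg.2 (by positivity))

end Feasibility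

end SoSLift

theorem theorem1p2 :
    ∃ C : ℝ, 0 < C ∧
      -- the universal polynomials that give the entries; they depend on nothing but `|S ∆ T|`
      ∃ Q : (k : ℕ) → MvPolynomial (Fin k × Fin k) ℚ,
        ∀ (n : ℕ) (X : Matrix (Fin n) (Fin n) ℝ), X ∈ SoSLift.SoS2 n →
          -- the limits in the definition of the lift exist, for every factor of `X`
          (∀ M : Matrix (Fin n) (Fin n) ℝ, M * M.transpose = X →
            ∀ S T : SoSLift.Idx n,
              Filter.Tendsto (SoSLift.seedMoment M (symmDiff S.1 T.1)) Filter.atTop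
                (nhds (SoSLift.momentMatrix X S T))) ∧
          SoSLift.lift C X ∈ SoSLift.SoS4 n ∧
          (∀ i j : Fin n, i ≠ j →
            SoSLift.lift C X (SoSLift.single i) (SoSLift.single j) =
              (X i j + 2 / 3 * X i j ^ 3) /
                (1 + C * SoSLift.alphaMag X * (1 + SoSLift.alphaRow X ^ 4) *
                  (1 + SoSLift.alphaSpec X ^ 2))) ∧
          (∀ (S T : SoSLift.Idx n) (k : ℕ) (e : Fin k ↪ Fin n),
            Finset.univ.map e = symmDiff S.1 T.1 →
              SoSLift.lift C X S T =
                (MvPolynomial.aeval (fun p : Fin k × Fin k => X (e p.1) (e p.2)) (Q k) +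
                    (if S = T then SoSLift.alpha C X else 0)) /
                  (1 + SoSLift.alpha C X)) := by
  have hC : (0 : ℝ) ≤ 200 := by norm_num
  refine ⟨200, by norm_num, SoSLift.momentPoly, fun n X hX =>
    ⟨fun M hM S T => SoSLift.tendsto_momentMatrix hX hM S T, SoSLift.lift_mem_SoS4 hX,
      fun i j hij => ?_, fun S T k e he => ?_⟩⟩
  · rw [SoSLift.lift_apply hC, if_neg (SoSLift.single_injective.ne hij), add_zero,
      SoSLift.momentMatrix_pair hX hij (SoSLift.single_symmDiff_single hij)]
    rfl
  · rw [SoSLift.lift_apply hC, SoSLift.momentMatrix_eq hX he]
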